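/- **Setting.** Let $\Omega\subset\mathbb R^3$ be a bounded, connected open set containing the origin, with boundary $\Gamma$ of class $C^2$, split into disjoint measurable parts $\Gamma=\Gamma_b\cup\Gamma_t\cup\Gamma_v$; put $\Gamma_{bt}=\Gamma_b\cup\Gamma_t$, $T>0$, $\mathcal Q=\Omega\times(0,T)$, $\Lambda=\Gamma_{bt}\times(0,T)$. Write $(\cdot,\cdot)$ for the $L^2(\Omega)$ product, $L^p(X)$ for $L^p(0,T;X)$, and $H=\{u\in L^2(\Omega)^3:\operatorname{div}u=0,\ u\cdot n=0\text{ on }\Gamma\}$, $H_\theta=\{\psi\in H^1(\Omega):\psi=0\text{ on }\Gamma_{bt}\}$, $H_v=\{w\in H^1(\Omega)^3:\operatorname{div}w=0,\ w=0\text{ on }\Gamma_{bt},\ w\cdot n=0\text{ on }\Gamma_v\}$. *Phase diagram.* Let $\theta_E<\theta_F$ and let $\gamma_\ell,\gamma_s:[\theta_E,\theta_F]\to\mathbb R$ be continuous and strictly decreasing with $\gamma_\ell(\theta_F)=\gamma_s(\theta_F)=0$ and $\gamma_s<\gamma_\ell$ on $[\theta_E,\theta_F)$; put $c_E=\gamma_\ell(\theta_E)$,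 $c_A=\gamma_s(\theta_E)$. In the $(c,\theta)$-plane let $\Theta_l=\{0<c<c_E,\ \theta>\gamma_\ell^{-1}(c)\}$, $\Theta_m=\{\theta_E<\theta<\theta_F,\ \gamma_s(\theta)<c<\gamma_\ell(\theta)\}$, $\Theta_s=\{0<c<c_A,\ \theta<\gamma_s^{-1}(c)\}$, $\Theta_\pm=\{\pm c>0\}\setminus\overline{\Theta_l\cup\Theta_s\cup\Theta_m}$, and $\Theta_{ml}=\Theta_m\cup\{c=\gamma_\ell(\theta),\ \theta_E<\theta<\theta_F\}\cup\Theta_l$. Let $c_l(c,\theta)$ be $c$ on $\Theta_l$, $\gamma_\ell(\gamma_s^{-1}(c))$ on $\Theta_s$, $0$ on $\overline{\Theta_-}$, $c_E$ on $\overline{\Theta_+}$, and $\gamma_\ell(\theta)$ on the rest of $\overline{\Theta_m}$; assume $c_l\in W^{1,\infty}(\mathbb R^2)$. Let $f_s$ be $\frac{\gamma_\ell(\theta)-c}{\gamma_\ell(\theta)-\gamma_s(\theta)}$ on $\Theta_m$, $1$ on $\overline{\Theta_s\cup\Theta_+}$ and $0$ elsewhere. *Coefficients and data.* Let $\eta,\kappa,C_0>0$,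 let $\nu,\rho,C_p,\alpha,\beta,\theta_r,c_r,g\in\mathbb R$, and $F_i=C_0f_s^2/(1-f_s)^3$, $\mathbf F_e(c,\theta)=\rho\,(0,0,-g)^t\,(\alpha(\theta-\theta_r)+\beta(c_l(c,\theta)-c_r))$. Let $0\le c_g\le\gamma_\ell(\theta_E)|\Omega|$. Let $\theta_\delta\in H^1(0,T;L^\infty(\Gamma_{bt}))$ be the trace on $\Gamma_{bt}$ of a function, also called $\theta_\delta$, in $H^1(0,T;H^1(\Omega))$ with $\theta_\delta(\cdot,0)=\theta_\delta(\cdot,T)$ in $\Omega$. *Weak reproductive solutions.* $(c,\theta,v)$ is a weak reproductive solution, with $c_0,\theta_0\in L^2(\Omega)$ and $v_0\in H$, if * $c,\theta\in L^2(H^1(\Omega))\cap L^\infty(L^2(\Omega))$, $v\in L^2(H_v)\cap L^\infty(H)$; * $c(0)=c(T)=c_0$, $\theta(0)=\theta(T)=\theta_0$, $v(0)=v(T)=v_0$ a.e. in $\Omega$, where $c,\theta$ are taken as their weakly continuous representatives $[0,T]\to L^2(\Omega)$ and the end values of $v$ are weak $L^2$ limits; * for a.e. $t\in(0,T)$: $\int_\Omega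 c(x,t)\,dx=c_g$ and $\theta(\cdot,t)-\theta_\delta(\cdot,t)\in H_\theta$; * $v=0$ a.e. on $\{(x,t)\in\mathcal Q:(c,\theta)(x,t)\in\Theta_s\}$; * in the sense of distributions on $(0,T)$, $$\tfrac{d}{dt}(c,\varphi)+\eta(\nabla c,\nabla\varphi)+(v\cdot\nabla c_l(c,\theta),\varphi)=0\quad\forall\varphi\in H^1(\Omega),$$ $$\tfrac{d}{dt}(\theta,\psi)+\kappa(\nabla\theta,\nabla\psi)+\rho C_p(v\cdot\nabla\theta,\psi)=0\quad\forall\psi\in H_\theta,$$ $$\tfrac{d}{dt}(v,w)+\nu(\nabla v,\nabla w)+\rho((v\cdot\nabla)v,w)+(F_i(c,\theta)v,w)=(\mathbf F_e(c,\theta),w)$$ for all $w\in H_v$ with support in the mixture–liquid region; that is, the last equation is tested with $w(x)\zeta(t)$, $w\in H_v$ vanishing outside a compact $K\subset\Omega$, $\zeta\in C_c^\infty(0,T)$, such that $(c,\theta)$ takes a.e. on $K\times\operatorname{supp}\zeta$ values in a compact subset of $\Theta_{ml}$. No bound on $c$ is assumed. **Proposition 3.5.** Every weak reproductive solution $(c,\theta,v)$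 satisfies $$0\le c(x,t)\le\gamma_\ell(\theta_E)\quad\text{and}\quad\theta_\delta^{\inf}\le\theta(x,t)\le\theta_\delta^{\sup}\qquad\text{for a.e. }(x,t)\in\mathcal Q,$$ where $\theta_\delta^{\inf}=\min\{\inf_\Omega\theta_0,\ \inf_\Lambda\theta_\delta\}$ and $\theta_\delta^{\sup}=\max\{\sup_\Omega\theta_0,\ \sup_\Lambda\theta_\delta\}$ (essential infima and suprema, with values in $[-\infty,\infty]$). -/

import Mathlib

open MeasureTheory Set Filter Topology
open scoped ENNReal ContDiff

namespace Solidification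

noncomputable section

/-- Physical space `ℝ³` with the Euclidean norm. -/
abbrev E3 : Type := EuclideanSpace ℝ (Fin 3)

/-! ### Sobolev functions -/

/-- `g` is the weak (distributional) derivative of `u` on the open set `Ω`. -/
def HasWeakFDeriv {V : Type*} [NormedAddCommGroup V] [NormedSpace ℝ V] [MeasureSpace V]
    (Ω : Set V) (u : V → ℝ) (g : V → V →L[ℝ] ℝ) : Prop :=
  ∀ φ : V → ℝ, ContDiff ℝ ∞ φ → HasCompactSupport φ → tsupport φ ⊆ Ω →
    ∀ y : V, ∫ x in Ω, u x * fderiv ℝ φ x y = -∫ x in Ω, φ x * g x y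

/-- The space `W^{1,∞}(V)`. -/
def MemW1Infty {V : Type*} [NormedAddCommGroup V] [NormedSpace ℝ V] [MeasureSpace V]
    (u : V → ℝ) : Prop :=
  MemLp u ∞ volume ∧ ∃ g : V → V →L[ℝ] ℝ, MemLp g ∞ volume ∧ HasWeakFDeriv univ u g

/-- `u ∈ H¹(Ω)` with weak gradient `Du`. -/
structure IsH1 (Ω : Set E3) (u : E3 → ℝ) (Du : E3 → E3) : Prop where
  memLp : MemLp u 2 (volume.restrict Ω)
  memLp_grad : MemLp Du 2 (volume.restrict Ω)
  weak : HasWeakFDeriv Ω u (fun x => innerSL ℝ (Du x))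

/-- Surface measure: the two-dimensional Hausdorff measure (up to a constant factor, which
plays no role here). -/
def surf : Measure E3 := Measure.hausdorffMeasure 2

/-- `τ ∈ L²(∂Ω)` is the boundary trace of `u ∈ H¹(Ω)` (with weak gradient `Du`): the pair
`(u, τ)` is the limit in `H¹(Ω) × L²(∂Ω)` of pairs `(φₙ|_Ω, φₙ|_{∂Ω})` with `φₙ ∈ C¹(ℝ³)`. -/
def HasTrace (Ω : Set E3) (u : E3 → ℝ) (Du : E3 → E3) (τ : E3 → ℝ) : Prop :=
  IsH1 Ω u Du ∧ MemLp τ 2 (surf.restrict (frontier Ω)) ∧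
  ∃ φ : ℕ → E3 → ℝ, (∀ n, ContDiff ℝ 1 (φ n)) ∧
    Tendsto (fun n => eLpNorm (fun x => φ n x - u x) 2 (volume.restrict Ω)) atTop (𝓝 0) ∧
    Tendsto (fun n => eLpNorm (fun x => gradient (φ n) x - Du x) 2 (volume.restrict Ω))
      atTop (𝓝 0) ∧
    Tendsto (fun n => eLpNorm (fun x => φ n x - τ x) 2 (surf.restrict (frontier Ω)))
      atTop (𝓝 0)

/-! ### Domains with `C²` boundary -/

/-- `f` is a `C²` defining function of `Ω` on the neighbourhood `U` of the boundary point `x₀`. -/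
structure IsLocalDefiningFunction (Ω : Set E3) (x₀ : E3) (U : Set E3) (f : E3 → ℝ) : Prop where
  isOpen : IsOpen U
  mem : x₀ ∈ U
  contDiffOn : ContDiffOn ℝ 2 f U
  apply_eq_zero : f x₀ = 0
  gradient_ne_zero : gradient f x₀ ≠ 0
  inter_eq : U ∩ Ω = {x ∈ U | f x < 0}

/-- The boundary of `Ω` is of class `C²` (and `Ω` lies locally on one side of it). -/
def HasC2Boundary (Ω : Set E3) : Prop :=
  ∀ x₀ ∈ frontier Ω, ∃ U f, IsLocalDefiningFunction Ω x₀ U f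

/-- `n` is the outward unit normal to `∂Ω` at the boundary point `x`. -/
def IsOuterUnitNormal (Ω : Set E3) (x n : E3) : Prop :=
  ∃ U f, IsLocalDefiningFunction Ω x U f ∧ n = ‖gradient f x‖⁻¹ • gradient f x

/-! ### The function spaces of the problem -/

/-- `ψ ∈ H_θ`: `ψ ∈ H¹(Ω)` (with weak gradient `Dψ`) and `ψ = 0` on `Γbt`. -/
def MemHtheta (Ω Γbt : Set E3) (ψ : E3 → ℝ) (Dψ : E3 → E3) : Prop :=
  ∃ τ : E3 → ℝ, HasTrace Ω ψ Dψ τ ∧ ∀ᵐ x ∂surf.restrict Γbt, τ x = 0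

/-- `u ∈ H`: `u ∈ L²(Ω)³`, `div u = 0` in `Ω`, `u · n = 0` on `∂Ω`. For `u ∈ L²` with `div u = 0`
the normal trace is the functional `⟨u · n, φ⟩ = ∫_Ω u · ∇φ` on `H¹(Ω)`. -/
structure MemH (Ω : Set E3) (u : E3 → E3) : Prop where
  memLp : MemLp u 2 (volume.restrict Ω)
  div_eq_zero : ∀ φ : E3 → ℝ, ContDiff ℝ ∞ φ → HasCompactSupport φ → tsupport φ ⊆ Ω →
    ∫ x in Ω, fderiv ℝ φ x (u x) = 0
  normal_eq_zero : ∀ φ Dφ, IsH1 Ω φ Dφ → ∫ x in Ω, inner ℝ (u x) (Dφ x) = 0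

/-- `w ∈ H_v`: `w ∈ H¹(Ω)³` (where `Dw i` is the weak gradient of the `i`-th component),
`div w = 0` in `Ω`, `w = 0` on `Γbt` and `w · n = 0` on `Γv`. -/
structure MemHv (Ω Γbt Γv : Set E3) (w : E3 → E3) (Dw : Fin 3 → E3 → E3) : Prop where
  isH1 : ∀ i, IsH1 Ω (fun x => w x i) (Dw i)
  div_eq_zero : ∀ᵐ x ∂volume.restrict Ω, ∑ i, Dw i x i = 0
  boundary : ∃ τ : E3 → E3, (∀ i, HasTrace Ω (fun x => w x i) (Dw i) (fun x => τ x i)) ∧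
    (∀ᵐ x ∂surf.restrict Γbt, τ x = 0) ∧
    ∀ᵐ x ∂surf.restrict Γv, ∀ n, IsOuterUnitNormal Ω x n → inner ℝ (τ x) n = 0

/-- `b ∈ H¹(0,T;X)`, represented by its continuous representative on `[0,T]`. -/
def MemBochnerH1 {X : Type*} [NormedAddCommGroup X] [NormedSpace ℝ X] (T : ℝ) (b : ℝ → X) :
    Prop :=
  ∃ b' : ℝ → X, MemLp b' 2 (volume.restrict (Ioo 0 T)) ∧
    ∀ t ∈ Icc 0 T, b t = b 0 + ∫ s in (0 : ℝ)..t, b' s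

/-- Lebesgue measure on the space-time cylinder; points are written `(t, x)`. -/
def cylinder (Ω : Set E3) (T : ℝ) : Measure (ℝ × E3) :=
  (volume.restrict (Ioo 0 T)).prod (volume.restrict Ω)

/-- The bound in `L^∞(0,T;L²(Ω))`. -/
def BddInL2 {F : Type*} [NormedAddCommGroup F] (Ω : Set E3) (T : ℝ) (u : ℝ → E3 → F) : Prop :=
  ∃ M : ℝ, ∀ᵐ t ∂volume.restrict (Ioo 0 T),
    eLpNorm (u t) 2 (volume.restrict Ω) ≤ ENNReal.ofReal M

/-- `u ∈ L²(0,T;H¹(Ω))` with spatial weak gradient `Du`. -/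
structure MemL2H1 (Ω : Set E3) (T : ℝ) (u : ℝ → E3 → ℝ) (Du : ℝ → E3 → E3) : Prop where
  memLp : MemLp (fun p : ℝ × E3 => u p.1 p.2) 2 (cylinder Ω T)
  memLp_grad : MemLp (fun p : ℝ × E3 => Du p.1 p.2) 2 (cylinder Ω T)
  isH1 : ∀ᵐ t ∂volume.restrict (Ioo 0 T), IsH1 Ω (u t) (Du t)

/-- `u` is the representative that is weakly continuous from `[0,T]` to `L²(Ω)`; this is what
gives a meaning to the values of `u` at the times `0` and `T`. -/
def WeaklyContinuousL2 (Ω : Set E3) (T : ℝ) (u : ℝ → E3 → ℝ) : Prop :=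
  (∀ t ∈ Icc 0 T, MemLp (u t) 2 (volume.restrict Ω)) ∧
  ∀ φ : E3 → ℝ, MemLp φ 2 (volume.restrict Ω) →
    ContinuousOn (fun t => ∫ x in Ω, u t x * φ x) (Icc 0 T)

/-- `v(t) ⇀ a` weakly in `L²(Ω)³` along the filter `l` of times (up to null sets of times). -/
def WeakTimeLimit (Ω : Set E3) (v : ℝ → E3 → E3) (l : Filter ℝ) (a : E3 → E3) : Prop :=
  ∀ φ : E3 → E3, MemLp φ 2 (volume.restrict Ω) →
    Tendsto (fun t => ∫ x in Ω, inner ℝ (v t x) (φ x)) (l ⊓ ae volume)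
      (𝓝 (∫ x in Ω, inner ℝ (a x) (φ x)))

/-- `ζ` is a test function on `(0,T)`. -/
def IsTimeTest (T : ℝ) (ζ : ℝ → ℝ) : Prop :=
  ContDiff ℝ ∞ ζ ∧ HasCompactSupport ζ ∧ tsupport ζ ⊆ Ioo 0 T

/-! ### The phase diagram -/

/-- Eutectic and fusion temperatures, liquidus `γl` and solidus `γs` of a binary alloy. -/
structure PhaseDiagram where
  θE : ℝ
  θF : ℝ
  γl : ℝ → ℝ
  γs : ℝ → ℝ
  θE_lt_θF : θE < θF
  continuousOn_γl : ContinuousOn γl (Icc θE θF)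
  continuousOn_γs : ContinuousOn γs (Icc θE θF)
  strictAntiOn_γl : StrictAntiOn γl (Icc θE θF)
  strictAntiOn_γs : StrictAntiOn γs (Icc θE θF)
  γl_θF : γl θF = 0
  γs_θF : γs θF = 0
  γs_lt_γl : ∀ θ ∈ Ico θE θF, γs θ < γl θ

namespace PhaseDiagram

variable (P : PhaseDiagram)

def cE : ℝ := P.γl P.θE

def cA : ℝ := P.γs P.θE

/-- The inverse of the liquidus curve, `[0, cE] → [θE, θF]`. -/
def γlInv : ℝ → ℝ := Function.invFunOn P.γl (Icc P.θE P.θF)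

/-- The inverse of the solidus curve, `[0, cA] → [θE, θF]`. -/
def γsInv : ℝ → ℝ := Function.invFunOn P.γs (Icc P.θE P.θF)

/-- Liquid zone, in the `(c, θ)` plane. -/
def zoneL : Set (ℝ × ℝ) := {z | 0 < z.1 ∧ z.1 < P.cE ∧ P.γlInv z.1 < z.2}

/-- Mixture zone. -/
def zoneM : Set (ℝ × ℝ) :=
  {z | P.θE < z.2 ∧ z.2 < P.θF ∧ P.γs z.2 < z.1 ∧ z.1 < P.γl z.2}

/-- Solid zone. -/
def zoneS : Set (ℝ × ℝ) := {z | 0 < z.1 ∧ z.1 < P.cA ∧ z.2 < P.γsInv z.1}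

def zonePlus : Set (ℝ × ℝ) := {z | 0 < z.1} \ closure (P.zoneL ∪ P.zoneS ∪ P.zoneM)

def zoneMinus : Set (ℝ × ℝ) := {z | z.1 < 0} \ closure (P.zoneL ∪ P.zoneS ∪ P.zoneM)

/-- Mixture and liquid zones together with the interface between them. -/
def zoneML : Set (ℝ × ℝ) :=
  P.zoneM ∪ {z | P.θE < z.2 ∧ z.2 < P.θF ∧ z.1 = P.γl z.2} ∪ P.zoneL

open Classical in
/-- Concentration of solute in the liquid phase, extended to the whole plane. The last case
covers the points of the closed mixture zone that are not boundary points of `zoneMinus` or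
`zonePlus`. -/
def cl (z : ℝ × ℝ) : ℝ :=
  if z ∈ P.zoneL then z.1
  else if z ∈ P.zoneS then P.γl (P.γsInv z.1)
  else if z ∈ closure P.zoneMinus then 0
  else if z ∈ closure P.zonePlus then P.cE
  else P.γl z.2

open Classical in
/-- Solid fraction, extended to the whole plane. -/
def fs (z : ℝ × ℝ) : ℝ :=
  if z ∈ P.zoneM then (P.γl z.2 - z.1) / ((P.γl z.2 - z.1) + (z.1 - P.γs z.2))
  else if z ∈ closure (P.zoneS ∪ P.zonePlus) then 1
  else 0

end PhaseDiagram

/-! ### The data of the problem -/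

/-- The data of the solidification problem, with the standing hypotheses on them. -/
structure Data where
  /-- the mould and the parts (bottom, top, vertical) of its boundary -/
  Ω : Set E3
  Γb : Set E3
  Γt : Set E3
  Γv : Set E3
  isOpen : IsOpen Ω
  isConnected : IsConnected Ω
  zero_mem : (0 : E3) ∈ Ω
  isBounded : Bornology.IsBounded Ω
  boundary_C2 : HasC2Boundary Ω
  measurableSet_Γb : MeasurableSet Γb
  measurableSet_Γt : MeasurableSet Γt
  measurableSet_Γv : MeasurableSet Γv
  union_eq : Γb ∪ Γt ∪ Γv = frontier Ω
  disjoint_bt : Disjoint Γb Γt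
  disjoint_bv : Disjoint Γb Γv
  disjoint_tv : Disjoint Γt Γv
  /-- the final time -/
  T : ℝ
  T_pos : 0 < T
  /-- the phase diagram; the liquid concentration is in `W^{1,∞}(ℝ²)` -/
  P : PhaseDiagram
  cl_mem : MemW1Infty P.cl
  /-- physical constants -/
  η : ℝ
  κ : ℝ
  ν : ℝ
  ρ : ℝ
  Cp : ℝ
  C0 : ℝ
  α : ℝ
  β : ℝ
  θr : ℝ
  cr : ℝ
  grav : ℝ
  η_pos : 0 < η
  κ_pos : 0 < κ
  C0_pos : 0 < C0
  /-- total quantity of solute, with the compatibility relation -/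
  cg : ℝ
  cg_nonneg : 0 ≤ cg
  cg_le : cg ≤ P.γl P.θE * volume.real Ω
  /-- temperature prescribed on `Γb ∪ Γt`, in `H¹(0,T;L^∞(Γb ∪ Γt))` -/
  θδ : ℝ → Lp ℝ ∞ (surf.restrict (Γb ∪ Γt))
  θδ_mem : MemBochnerH1 T θδ
  /-- its extension to `Ω` in `H¹(0,T;H¹(Ω))`, and the spatial gradient of the extension -/
  ext : ℝ → Lp ℝ 2 (volume.restrict Ω)
  Dext : ℝ → Lp E3 2 (volume.restrict Ω)
  ext_isH1 : ∀ t ∈ Icc 0 T, IsH1 Ω (ext t) (Dext t)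
  ext_mem : MemBochnerH1 T ext
  Dext_mem : MemBochnerH1 T Dext
  ext_trace : ∀ᵐ t ∂volume.restrict (Ioo 0 T), ∃ τ : E3 → ℝ,
    HasTrace Ω (ext t) (Dext t) τ ∧ ∀ᵐ x ∂surf.restrict (Γb ∪ Γt), τ x = θδ t x
  ext_periodic : ext 0 = ext T

namespace Data

variable (D : Data)

def Γbt : Set E3 := D.Γb ∪ D.Γt

/-- The measure of the cylinder `Q`. -/
def Q : Measure (ℝ × E3) := cylinder D.Ω D.T

/-- Carman–Kozeny term. -/
def Fi (z : ℝ × ℝ) : ℝ := D.C0 * (D.P.fs z ^ 2 / (1 - D.P.fs z) ^ 3)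

/-- External force (Boussinesq approximation), with gravity `(0, 0, -grav)`. -/
def Fe (z : ℝ × ℝ) : E3 :=
  (D.ρ * (D.α * (z.2 - D.θr) + D.β * (D.P.cl z - D.cr))) • !₂[(0 : ℝ), 0, -D.grav]

/-- `inf_Λ θδ` for `Λ = Γbt × (0,T)` (essential infimum). -/
def infΛ : EReal :=
  essInf (fun t => essInf (fun x => ((D.θδ t x : ℝ) : EReal)) (surf.restrict (D.Γb ∪ D.Γt)))
    (volume.restrict (Ioo 0 D.T))

/-- `sup_Λ θδ` for `Λ = Γbt × (0,T)` (essential supremum). -/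
def supΛ : EReal :=
  essSup (fun t => essSup (fun x => ((D.θδ t x : ℝ) : EReal)) (surf.restrict (D.Γb ∪ D.Γt)))
    (volume.restrict (Ioo 0 D.T))

/-- `min {inf_Ω θ₀, inf_Λ θδ}`, an extended real because `θ₀` is only in `L²(Ω)`. -/
def θinf (θ₀ : E3 → ℝ) : EReal :=
  min (essInf (fun x => (θ₀ x : EReal)) (volume.restrict D.Ω)) D.infΛ

/-- `max {sup_Ω θ₀, sup_Λ θδ}`, an extended real because `θ₀` is only in `L²(Ω)`. -/
def θsup (θ₀ : E3 → ℝ) : EReal :=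
  max (essSup (fun x => (θ₀ x : EReal)) (volume.restrict D.Ω)) D.supΛ

end Data

/-! ### Weak reproductive solutions -/

/-- `(c, θ, v)` is a weak reproductive solution with time-periodic values `c₀, θ₀, v₀`; here `Dc`,
`Dθ`, `Dv · i`, `Dcl` are the weak spatial gradients of `c`, `θ`, the `i`-th component of `v`, and
`cl(c, θ)`. No bound on `c` is part of the definition. -/
structure IsWeakReproductiveSolutionWith (D : Data)
    (c θ : ℝ → E3 → ℝ) (v : ℝ → E3 → E3) (c₀ θ₀ : E3 → ℝ) (v₀ : E3 → E3)
    (Dc Dθ : ℝ → E3 → E3) (Dv : ℝ → Fin 3 → E3 → E3) (Dcl : ℝ → E3 → E3) : Prop where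
  c₀_mem : MemLp c₀ 2 (volume.restrict D.Ω)
  θ₀_mem : MemLp θ₀ 2 (volume.restrict D.Ω)
  v₀_mem : MemH D.Ω v₀
  -- regularity
  c_mem : MemL2H1 D.Ω D.T c Dc
  c_bdd : BddInL2 D.Ω D.T c
  c_cont : WeaklyContinuousL2 D.Ω D.T c
  θ_mem : MemL2H1 D.Ω D.T θ Dθ
  θ_bdd : BddInL2 D.Ω D.T θ
  θ_cont : WeaklyContinuousL2 D.Ω D.T θ
  cl_mem : MemL2H1 D.Ω D.T (fun t x => D.P.cl (c t x, θ t x)) Dcl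
  v_memLp : MemLp (fun p : ℝ × E3 => v p.1 p.2) 2 D.Q
  Dv_memLp : ∀ i, MemLp (fun p : ℝ × E3 => Dv p.1 i p.2) 2 D.Q
  v_memHv : ∀ᵐ t ∂volume.restrict (Ioo 0 D.T), MemHv D.Ω D.Γbt D.Γv (v t) (Dv t)
  v_memH : ∀ᵐ t ∂volume.restrict (Ioo 0 D.T), MemH D.Ω (v t)
  v_bdd : BddInL2 D.Ω D.T v
  v_limit_zero : WeakTimeLimit D.Ω v (𝓝[>] 0) (v 0)
  v_limit_T : WeakTimeLimit D.Ω v (𝓝[<] D.T) (v D.T)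
  -- values at the times `0` and `T`
  c_T : ∀ᵐ x ∂volume.restrict D.Ω, c D.T x = c₀ x
  θ_T : ∀ᵐ x ∂volume.restrict D.Ω, θ D.T x = θ₀ x
  v_T : ∀ᵐ x ∂volume.restrict D.Ω, v D.T x = v₀ x
  c_periodic : ∀ᵐ x ∂volume.restrict D.Ω, c 0 x = c D.T x
  θ_periodic : ∀ᵐ x ∂volume.restrict D.Ω, θ 0 x = θ D.T x
  v_periodic : ∀ᵐ x ∂volume.restrict D.Ω, v 0 x = v D.T x
  -- mass constraint, boundary temperature, rest in the solid
  mass : ∀ᵐ t ∂volume.restrict (Ioo 0 D.T), ∫ x in D.Ω, c t x = D.cg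
  θ_boundary : ∀ᵐ t ∂volume.restrict (Ioo 0 D.T), MemHtheta D.Ω D.Γbt
    (fun x => θ t x - D.ext t x) (fun x => Dθ t x - D.Dext t x)
  v_solid : ∀ᵐ p ∂D.Q, (c p.1 p.2, θ p.1 p.2) ∈ D.P.zoneS → v p.1 p.2 = 0
  -- the equations, in the sense of distributions on `(0,T)`
  eq_c : ∀ φ Dφ, IsH1 D.Ω φ Dφ → ∀ ζ, IsTimeTest D.T ζ →
    -(∫ t in Ioo 0 D.T, deriv ζ t * ∫ x in D.Ω, c t x * φ x)
      + ∫ t in Ioo 0 D.T, ζ t *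
        (D.η * (∫ x in D.Ω, inner ℝ (Dc t x) (Dφ x))
          + ∫ x in D.Ω, inner ℝ (v t x) (Dcl t x) * φ x) = 0
  eq_θ : ∀ ψ Dψ, MemHtheta D.Ω D.Γbt ψ Dψ → ∀ ζ, IsTimeTest D.T ζ →
    -(∫ t in Ioo 0 D.T, deriv ζ t * ∫ x in D.Ω, θ t x * ψ x)
      + ∫ t in Ioo 0 D.T, ζ t *
        (D.κ * (∫ x in D.Ω, inner ℝ (Dθ t x) (Dψ x))
          + D.ρ * D.Cp * ∫ x in D.Ω, inner ℝ (v t x) (Dθ t x) * ψ x) = 0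
  -- test functions `w ζ` supported in the mixture-liquid part of the cylinder: `w` vanishes outside
  -- a compact `K ⊆ Ω`, and on `K × supp ζ` the pair `(c, θ)` stays in a compact part of that zone
  eq_v : ∀ w Dw, MemHv D.Ω D.Γbt D.Γv w Dw → ∀ ζ, IsTimeTest D.T ζ →
    ∀ K : Set E3, IsCompact K → K ⊆ D.Ω → (∀ᵐ x ∂volume.restrict D.Ω, x ∉ K → w x = 0) →
    ∀ C : Set (ℝ × ℝ), IsCompact C → C ⊆ D.P.zoneML →
    (∀ᵐ p ∂D.Q, p.1 ∈ tsupport ζ → p.2 ∈ K → (c p.1 p.2, θ p.1 p.2) ∈ C) →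
    -(∫ t in Ioo 0 D.T, deriv ζ t * ∫ x in D.Ω, inner ℝ (v t x) (w x))
      + ∫ t in Ioo 0 D.T, ζ t *
        (D.ν * (∫ x in D.Ω, ∑ i, inner ℝ (Dv t i x) (Dw i x))
          + D.ρ * (∫ x in D.Ω, ∑ i, inner ℝ (v t x) (Dv t i x) * w x i)
          + ∫ x in D.Ω, D.Fi (c t x, θ t x) * inner ℝ (v t x) (w x))
      = ∫ t in Ioo 0 D.T, ζ t * ∫ x in D.Ω, inner ℝ (D.Fe (c t x, θ t x)) (w x)

/-- `(c, θ, v)` is a weak reproductive solution at time `T`, where `c₀, θ₀, v₀` are the common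
values at the times `0` and `T`. -/
def IsWeakReproductiveSolution (D : Data)
    (c θ : ℝ → E3 → ℝ) (v : ℝ → E3 → E3) (c₀ θ₀ : E3 → ℝ) (v₀ : E3 → E3) : Prop :=
  ∃ Dc Dθ Dv Dcl, IsWeakReproductiveSolutionWith D c θ v c₀ θ₀ v₀ Dc Dθ Dv Dcl

end

end Solidification

/-! Both bounds come from testing each equation with a truncation `G` of its own unknown, where `G`
is the derivative of a convex `Φ` that vanishes on the allowed side of a level. This gives an energy
inequality for `∫ Φ(u(t))`, whose dissipation is the integral of `G'(u) |∇u|²`.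

Concentration: outside `0 ≤ c ≤ cE` the liquid concentration is constant (`cl_of_neg`, `cl_of_gt`).
A weak gradient vanishes a.e. on level sets (`IsH1.grad_eq_zero_of_eq`), so the convective term
disappears wherever `G(c) ≠ 0`. Over a full period the energies at `0` and `T` agree, hence the
dissipation is zero. For a.e. `t` the function `G(c(t))` therefore has zero gradient and is constant
on the connected set `Ω`. A nonzero constant would place `c(t)` beyond the level almost everywhere,
against the prescribed mass.

Temperature: at a level beyond the data, `G(θ)` has zero trace on `Γbt` and is an admissible test
function. This needs traces to commute with `G` (`HasTrace.comp_real`), where finiteness of the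
surface measure of the boundary (`surf_frontier_lt_top`) keeps compositions square integrable. The
convective term is the integral of `v · ∇Φ(θ)`, zero because `v(t) ∈ H`. The energy starts at zero
and so stays zero.

The analytic core is `energy_inequality`. The convective terms are products of two `L²` functions,
hence only `L¹` in space-time, so `∂ₜu` need not lie in the dual of `L²(H¹)` and the usual chain
rule in time is not at hand. Instead the equation is tested with `G(u(t))` frozen at time `t` and
integrated over `(t - h, t)`. Convexity bounds the increment of the energy, continuity of
translations in `L²` and `L¹` handles `h → 0`, and weak lower semicontinuity recovers the energy at
the final time. Boundedness of `G` lets it pair with the `L¹` term; its `C¹` smoothness reduces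
every chain rule to mollification. -/

namespace Solidification

noncomputable section

/-! ### Translations and mollification in `L^p` -/

section Mollification

variable {V : Type*} [NormedAddCommGroup V] [NormedSpace ℝ V] [FiniteDimensional ℝ V]
  [MeasurableSpace V] [BorelSpace V] {μ : Measure V} [μ.IsAddHaarMeasure]
  {F : Type*} [NormedAddCommGroup F]

/-- Translation is continuous in `L^p`, `1 ≤ p < ∞`. -/
theorem tendsto_eLpNorm_translate_sub {p : ℝ≥0∞} (hp1 : 1 ≤ p) (hp : p ≠ ⊤) {f : V → F}
    (hf : MemLp f p μ) :
    Tendsto (fun y => eLpNorm (fun x => f (x - y) - f x) p μ) (𝓝 0) (𝓝 0) := by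
  have : Fact (1 ≤ p) := ⟨hp1⟩
  have : ProperSpace V := FiniteDimensional.proper ℝ V
  let g : V → C(V, V) := fun y => ⟨fun x => x - y, by fun_prop⟩
  -- Continuity of `y ↦ (x ↦ x - y)` in the compact-open topology is what composition in `L^p` asks
  -- for; currying provides it.
  have hg : Continuous g := by
    have : Continuous (fun a : V × V => a.2 - a.1) := by fun_prop
    exact (ContinuousMap.curry ⟨_, this⟩).continuous
  have hgm : ∀ y, MeasurePreserving (g y) μ μ := fun y => measurePreserving_sub_right μ y
  have key := Filter.Tendsto.compMeasurePreservingLp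
    (f := fun _ : V => hf.toLp f) (l := 𝓝 (0 : V)) tendsto_const_nhds (hg.tendsto 0) hgm
    (hgm 0) hp
  rw [tendsto_iff_edist_tendsto_0] at key
  refine key.congr fun y => ?_
  rw [Lp.edist_def]
  refine eLpNorm_congr_ae ?_
  have h1 : ∀ z, (Lp.compMeasurePreserving (g z) (hgm z) (hf.toLp f) : V → F)
      =ᵐ[μ] fun x => f (x - z) := fun z =>
    (Lp.coeFn_compMeasurePreserving _ _).trans
      ((hgm z).quasiMeasurePreserving.ae_eq_comp hf.coeFn_toLp)
  filter_upwards [h1 y, h1 0] with x hx hx0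
  simp only [Pi.sub_apply, hx, hx0, sub_zero]

open ContinuousLinearMap in
/-- Mollifications converge in `L¹`. -/
theorem tendsto_integral_mollify_sub [NormedSpace ℝ F] [CompleteSpace F] {f : V → F}
    (hf : Integrable f μ) {φ : ℕ → ContDiffBump (0 : V)}
    (hφ : Tendsto (fun i => (φ i).rOut) atTop (𝓝 0)) :
    Tendsto (fun n => ∫ x, ‖(MeasureTheory.convolution ((φ n).normed μ) f (lsmul ℝ ℝ) μ) x - f x‖ ∂μ)
      atTop (𝓝 0) := by
  have htr := tendsto_eLpNorm_translate_sub le_rfl ENNReal.one_ne_top (memLp_one_iff_integrable.2 hf)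
  rw [Metric.tendsto_atTop]
  intro ε hε
  have h1 : ∀ᶠ y in 𝓝 (0 : V), eLpNorm (fun x => f (x - y) - f x) 1 μ < ENNReal.ofReal (ε / 2) :=
    htr.eventually (gt_mem_nhds (by simpa using hε))
  obtain ⟨δ, hδ, hball⟩ := Metric.eventually_nhds_iff.1 h1
  obtain ⟨N, hN⟩ := (Metric.tendsto_atTop.1 hφ) δ hδ
  refine ⟨N, fun n hn => ?_⟩
  have hr : (φ n).rOut < δ := by
    have := hN n hn
    rw [Real.dist_eq, sub_zero, abs_of_pos (φ n).rOut_pos] at this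
    exact this
  set ρ := (φ n).normed μ with hρ
  have hρi : Integrable ρ μ := (φ n).integrable_normed
  have hρ0 : ∀ y, 0 ≤ ρ y := (φ n).nonneg_normed
  have hint1 : Integrable (fun p : V × V => ρ p.2 • f (p.1 - p.2)) (μ.prod μ) :=
    hρi.convolution_integrand (lsmul ℝ ℝ) hf
  have hint2 : Integrable (fun p : V × V => ρ p.2 • f p.1) (μ.prod μ) := by
    have := (hρi.smul_prod hf).swap
    exact this
  have hint : Integrable (fun p : V × V => ρ p.2 • (f (p.1 - p.2) - f p.1)) (μ.prod μ) := by
    simp only [smul_sub]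
    exact hint1.sub hint2
  have hone : ∫ y, ρ y ∂μ = 1 := (φ n).integral_normed
  -- Since `ρ` has mass one, the error is an average over `y` of `f (x - y) - f x`. Fubini then
  -- leaves the `L¹` translation error, which is below `ε / 2` for `y` in the support of `ρ`.
  have hconv : ∀ᵐ x ∂μ, ‖(MeasureTheory.convolution ρ f (lsmul ℝ ℝ) μ) x - f x‖
      ≤ ∫ y, ‖ρ y • (f (x - y) - f x)‖ ∂μ := by
    filter_upwards [hint1.prod_right_ae] with x hx
    have e : (MeasureTheory.convolution ρ f (lsmul ℝ ℝ) μ) x - f x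
        = ∫ y, ρ y • (f (x - y) - f x) ∂μ := by
      simp only [smul_sub]
      rw [integral_sub hx (hρi.smul_const _), integral_smul_const, hone, one_smul]
      simp [MeasureTheory.convolution]
    rw [e]
    exact norm_integral_le_integral_norm _
  have hle : ∫ x, ‖(MeasureTheory.convolution ρ f (lsmul ℝ ℝ) μ) x - f x‖ ∂μ ≤ ε / 2 := by
    calc _ ≤ ∫ x, ∫ y, ‖ρ y • (f (x - y) - f x)‖ ∂μ ∂μ :=
          integral_mono_of_nonneg (.of_forall fun _ => norm_nonneg _)
            hint.norm.integral_prod_left hconv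
      _ = ∫ y, ∫ x, ‖ρ y • (f (x - y) - f x)‖ ∂μ ∂μ := integral_integral_swap hint.norm
      _ ≤ ∫ y, ρ y * (ε / 2) ∂μ := by
          refine integral_mono hint.norm.integral_prod_right (hρi.mul_const _) fun y => ?_
          simp only [norm_smul, Real.norm_of_nonneg (hρ0 y), integral_const_mul]
          by_cases hy : ρ y = 0
          · simp [hy]
          have hy' : y ∈ Metric.ball (0 : V) (φ n).rOut := by
            rw [← (φ n).support_normed_eq (μ := μ)]; exact hy
          refine mul_le_mul_of_nonneg_left ?_ (hρ0 y)
          have := hball (lt_trans hy' hr)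
          have hI : Integrable (fun x => f (x - y) - f x) μ := (hf.comp_sub_right y).sub hf
          rw [integral_norm_eq_lintegral_enorm hI.aestronglyMeasurable]
          rw [eLpNorm_one_eq_lintegral_enorm] at this
          exact ENNReal.toReal_le_of_le_ofReal (by positivity) this.le
      _ = ε / 2 := by rw [integral_mul_const, hone, one_mul]
  rw [Real.dist_eq, sub_zero, abs_of_nonneg (integral_nonneg fun _ => norm_nonneg _)]
  linarith

end Mollification

/-! ### Calculus of weak derivatives -/

section Bump

variable (V : Type*) [NormedAddCommGroup V]

/-- A sequence of bump functions shrinking to the origin. -/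
def bump (n : ℕ) : ContDiffBump (0 : V) where
  rIn := 1 / (n + 1 : ℝ) / 2
  rOut := 1 / (n + 1 : ℝ)
  rIn_pos := by positivity
  rIn_lt_rOut := half_lt_self (by positivity)

theorem tendsto_rOut_bump : Tendsto (fun n => (bump V n).rOut) atTop (𝓝 0) :=
  tendsto_one_div_add_atTop_nhds_zero_nat

end Bump

/-- A compact subset of `Ω` keeps a positive distance from the complement. For small radii,
mollification near `K` thus never sees the extension by zero. -/
theorem exists_closedBall_bump_subset {V : Type*} [NormedAddCommGroup V]
    {Ω : Set V} (hΩ : IsOpen Ω) {K : Set V} (hK : IsCompact K)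
    (hKΩ : K ⊆ Ω) : ∀ᶠ n in atTop, ∀ x ∈ K, Metric.closedBall x (bump V n).rOut ⊆ Ω := by
  obtain ⟨δ, hδ, hsub⟩ := hK.exists_cthickening_subset_open hΩ hKΩ
  filter_upwards [(tendsto_rOut_bump V).eventually (gt_mem_nhds hδ)] with n hn x hx
  exact ((Metric.closedBall_subset_closedBall hn.le).trans
    (Metric.closedBall_subset_cthickening hx δ)).trans hsub

theorem abs_sub_le_of_hasDerivAt {G G' : ℝ → ℝ} {C : ℝ} (hG : ∀ s, HasDerivAt G (G' s) s)
    (hC : ∀ s, |G' s| ≤ C) (a b : ℝ) : |G a - G b| ≤ C * |a - b| := by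
  simpa using convex_univ.norm_image_sub_le_of_norm_hasDerivWithin_le
    (f := G) (f' := G') (C := C) (fun x _ => (hG x).hasDerivWithinAt) (fun x _ => hC x)
    (mem_univ b) (mem_univ a)

theorem continuous_of_hasDerivAt {G G' : ℝ → ℝ} (hG : ∀ s, HasDerivAt G (G' s) s) :
    Continuous G :=
  continuous_iff_continuousAt.2 fun s => (hG s).continuousAt

section WeakDerivative

open ContinuousLinearMap

variable {V : Type*} [NormedAddCommGroup V] [InnerProductSpace ℝ V] [FiniteDimensional ℝ V]
  [MeasureSpace V] [BorelSpace V] [(volume : Measure V).IsAddHaarMeasure]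

/-- The mollification of a function, extended by zero outside `Ω`. -/
def mollify {F : Type*} [NormedAddCommGroup F] [NormedSpace ℝ F] (b : ContDiffBump (0 : V))
    (Ω : Set V) (u : V → F) : V → F :=
  MeasureTheory.convolution (b.normed volume) (Ω.indicator u) (lsmul ℝ ℝ) volume

variable {Ω : Set V} {u : V → ℝ} {Du : V → V}

theorem contDiff_mollify (hΩ : MeasurableSet Ω) (hu : IntegrableOn u Ω)
    (b : ContDiffBump (0 : V)) : ContDiff ℝ 1 (mollify b Ω u) :=
  b.hasCompactSupport_normed.contDiff_convolution_left (n := 1) _ b.contDiff_normed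
    ((integrable_indicator_iff hΩ).2 hu).locallyIntegrable

/-- The derivative falls on the kernel, and the reflected kernel is a legitimate test function once
its supporting ball lies in `Ω`. The minus sign from the reflection cancels the one in the
definition of the weak derivative. -/
theorem hasFDerivAt_mollify (hΩ : MeasurableSet Ω) (hu : IntegrableOn u Ω)
    (hDu : IntegrableOn Du Ω) (hw : HasWeakFDeriv Ω u (fun x => innerSL ℝ (Du x)))
    (b : ContDiffBump (0 : V)) {x : V} (hx : Metric.closedBall x b.rOut ⊆ Ω) :
    HasFDerivAt (mollify b Ω u) (innerSL ℝ (mollify b Ω Du x)) x := by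
  have hui := (integrable_indicator_iff hΩ).2 hu
  have hDui := (integrable_indicator_iff hΩ).2 hDu
  set ρ := b.normed (volume : Measure V) with hρ
  have hρs : HasCompactSupport ρ := b.hasCompactSupport_normed
  have hρc : ContDiff ℝ ∞ ρ := b.contDiff_normed
  have h1 := hρs.hasFDerivAt_convolution_left (lsmul ℝ ℝ) (hρc.of_le (by simp))
    hui.locallyIntegrable x
  refine h1.congr_fderiv ?_
  ext y
  have hfd : Continuous (fderiv ℝ ρ) := hρc.continuous_fderiv (by simp)
  have hex := ((hρs.fderiv ℝ).convolutionExists_left ((lsmul ℝ ℝ).precompL V) hfd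
    hui.locallyIntegrable x).integrable_swap
  have hex2 := (hρs.convolutionExists_left (lsmul ℝ ℝ) hρc.continuous
    hDui.locallyIntegrable x).integrable_swap
  rw [convolution_eq_swap, ContinuousLinearMap.integral_apply hex]
  rw [mollify, convolution_eq_swap, innerSL_apply_apply, ← real_inner_comm, ← integral_inner hex2]
  simp only [precompL_apply, lsmul_apply, smul_eq_mul]
  -- the test function is `t ↦ ρ (x - t)`
  have hφc : ContDiff ℝ ∞ (fun t => ρ (x - t)) := hρc.comp (contDiff_const.sub contDiff_id)
  have hsupp : Function.support (fun t => ρ (x - t)) ⊆ Metric.closedBall x b.rOut := by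
    intro t ht
    have : x - t ∈ Function.support ρ := ht
    rw [hρ, b.support_normed_eq] at this
    rw [Metric.mem_closedBall, dist_comm, dist_eq_norm]
    exact (mem_ball_zero_iff.1 this).le
  have hφs : HasCompactSupport (fun t => ρ (x - t)) :=
    HasCompactSupport.of_support_subset_isCompact (isCompact_closedBall _ _) hsupp
  have key := hw _ hφc hφs ((closure_minimal hsupp Metric.isClosed_closedBall).trans hx) y
  have hder : ∀ t, fderiv ℝ (fun t => ρ (x - t)) t y = -fderiv ℝ ρ (x - t) y := by
    intro t
    have := ((hρc.differentiable (by simp)) (x - t)).hasFDerivAt.comp t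
      ((hasFDerivAt_id t).const_sub x)
    have e : fderiv ℝ (fun t => ρ (x - t)) t = _ := HasFDerivAt.fderiv this
    simp [e]
  simp only [hder, mul_neg, integral_neg, neg_inj, innerSL_apply_apply] at key
  calc ∫ t, fderiv ℝ ρ (x - t) y * Ω.indicator u t
      = ∫ t, Ω.indicator (fun t => u t * fderiv ℝ ρ (x - t) y) t := by
        refine integral_congr_ae (.of_forall fun t => ?_)
        by_cases ht : t ∈ Ω <;> simp [ht, mul_comm]
    _ = ∫ t, Ω.indicator (fun t => ρ (x - t) * inner ℝ (Du t) y) t := by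
        rw [integral_indicator hΩ, integral_indicator hΩ, key]
    _ = _ := by
        refine integral_congr_ae (.of_forall fun t => ?_)
        by_cases ht : t ∈ Ω
        · simp only [ht, indicator_of_mem]
          rw [real_inner_smul_right, real_inner_comm]
        · simp [ht]

theorem ae_tendsto_mollify_bump {F : Type*} [NormedAddCommGroup F] [NormedSpace ℝ F]
    [CompleteSpace F] {f : V → F} (hΩ : MeasurableSet Ω) (hf : IntegrableOn f Ω) :
    ∀ᵐ x, Tendsto (fun n => mollify (bump V n) Ω f x) atTop (𝓝 (Ω.indicator f x)) :=
  -- The factor `2` is the ratio of outer to inner radius in `bump`; it must stay bounded for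
  -- convergence at almost every point.
  ContDiffBump.ae_convolution_tendsto_right_of_locallyIntegrable (K := 2) (tendsto_rOut_bump V)
    (.of_forall fun n => by simp only [bump]; linarith)
    ((integrable_indicator_iff hΩ).2 hf).locallyIntegrable

theorem tendsto_integral_mollify_bump {F : Type*} [NormedAddCommGroup F] [NormedSpace ℝ F]
    [CompleteSpace F] {f : V → F} (hΩ : MeasurableSet Ω) (hf : IntegrableOn f Ω) :
    Tendsto (fun n => ∫ x, ‖mollify (bump V n) Ω f x - Ω.indicator f x‖) atTop (𝓝 0) :=
  tendsto_integral_mollify_sub ((integrable_indicator_iff hΩ).2 hf) (tendsto_rOut_bump V)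

theorem integrable_mollify {F : Type*} [NormedAddCommGroup F] [NormedSpace ℝ F]
    [CompleteSpace F] {f : V → F} (hΩ : MeasurableSet Ω) (hf : IntegrableOn f Ω)
    (b : ContDiffBump (0 : V)) : Integrable (mollify b Ω f) :=
  b.integrable_normed.integrable_convolution _ ((integrable_indicator_iff hΩ).2 hf)

/-- Chain rule for weak derivatives. -/
theorem HasWeakFDeriv.comp_real (hΩ : IsOpen Ω) (hu : IntegrableOn u Ω) (hDu : IntegrableOn Du Ω)
    (hw : HasWeakFDeriv Ω u (fun x => innerSL ℝ (Du x))) {G G' : ℝ → ℝ} {C : ℝ}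
    (hG : ∀ s, HasDerivAt G (G' s) s) (hG'c : Continuous G') (hC : ∀ s, |G' s| ≤ C) :
    HasWeakFDeriv Ω (fun x => G (u x)) (fun x => innerSL ℝ (G' (u x) • Du x)) := by
  intro φ hφ hφs hφΩ y
  have hm := hΩ.measurableSet
  have hC0 : 0 ≤ C := (abs_nonneg _).trans (hC 0)
  have hGc : Continuous G := continuous_of_hasDerivAt hG
  have hGlip := abs_sub_le_of_hasDerivAt hG hC
  have hφc : Continuous φ := hφ.continuous
  have hdφc : Continuous (fun x => fderiv ℝ φ x y) := by
    have := hφ.continuous_fderiv (by simp)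
    fun_prop
  have hdφs : HasCompactSupport (fun x => fderiv ℝ φ x y) :=
    (hφs.fderiv ℝ).comp_left (g := fun L : V →L[ℝ] ℝ => L y) rfl
  obtain ⟨B, hB⟩ := hφs.exists_bound_of_continuous hφc
  obtain ⟨B', hB'⟩ := hdφs.exists_bound_of_continuous hdφc
  have hφ0 : ∀ x, x ∉ Ω → φ x = 0 := fun x hx => image_eq_zero_of_notMem_tsupport fun h => hx (hφΩ h)
  have hdφ0 : ∀ x, x ∉ tsupport φ → fderiv ℝ φ x y = 0 := fun x hx => by
    have : fderiv ℝ φ x = 0 := by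
      by_contra h
      exact hx (support_fderiv_subset ℝ h)
    simp [this]
  set U := Ω.indicator u with hU
  set D := Ω.indicator Du with hD
  have hUi : Integrable U := (integrable_indicator_iff hm).2 hu
  have hDi : Integrable D := (integrable_indicator_iff hm).2 hDu
  set un : ℕ → V → ℝ := fun n => mollify (bump V n) Ω u with hun
  set Dn : ℕ → V → V := fun n => mollify (bump V n) Ω Du with hDn
  have hunc : ∀ n, ContDiff ℝ 1 (un n) := fun n => contDiff_mollify hm hu _
  have huni : ∀ n, Integrable (un n) := fun n => integrable_mollify hm hu _
  have hDni : ∀ n, Integrable (Dn n) := fun n => integrable_mollify hm hDu _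
  have e1 : ∫ x in Ω, G (u x) * fderiv ℝ φ x y = ∫ x, G (U x) * fderiv ℝ φ x y := by
    refine (setIntegral_congr_fun hm fun x hx => ?_).trans
      (setIntegral_eq_integral_of_forall_compl_eq_zero (s := Ω) fun x hx => ?_)
    · simp [hU, hx]
    · rw [hdφ0 x fun h => hx (hφΩ h), mul_zero]
  have e2 : ∫ x in Ω, φ x * innerSL ℝ (G' (u x) • Du x) y
      = ∫ x, φ x * (G' (U x) * inner ℝ (D x) y) := by
    refine (setIntegral_congr_fun hm fun x hx => ?_).trans
      (setIntegral_eq_integral_of_forall_compl_eq_zero (s := Ω) fun x hx => ?_)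
    · simp [hU, hD, hx, innerSL_apply_apply]
    · rw [hφ0 x hx, zero_mul]
  rw [e1, e2]
  -- For mollified functions this is the classical chain rule and integration by parts. The gradient
  -- of `un n` is identified with `Dn n` only on `tsupport φ`, which is all that the test function
  -- sees.
  have hstep : ∀ᶠ n in atTop, ∫ x, G (un n x) * fderiv ℝ φ x y
      = -∫ x, φ x * (G' (un n x) * inner ℝ (Dn n x) y) := by
    filter_upwards [exists_closedBall_bump_subset hΩ hφs hφΩ] with n hn
    have hder : ∀ x, HasFDerivAt (fun x => G (un n x)) (G' (un n x) • fderiv ℝ (un n) x) x :=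
      fun x => (hG (un n x)).comp_hasFDerivAt x ((hunc n).differentiable (by simp) x).hasFDerivAt
    have hf' : Continuous (fun x => fderiv ℝ (fun x => G (un n x)) x y) := by
      have h1 : Continuous (fderiv ℝ (un n)) := (hunc n).continuous_fderiv (by simp)
      have h2 := (hunc n).continuous
      have : (fun x => fderiv ℝ (fun x => G (un n x)) x y)
          = fun x => G' (un n x) * fderiv ℝ (un n) x y := by
        ext x; rw [(hder x).fderiv]; simp
      rw [this]
      fun_prop
    have hf : Continuous (fun x => G (un n x)) := hGc.comp (hunc n).continuous
    rw [integral_mul_fderiv_eq_neg_fderiv_mul_of_integrable (f := fun x => G (un n x)) (g := φ)]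
    · congr 1
      refine integral_congr_ae (.of_forall fun x => ?_)
      by_cases hx : x ∈ tsupport φ
      · have := (hasFDerivAt_mollify hm hu hDu hw (bump V n) (hn x hx)).fderiv
        simp only
        rw [(hder x).fderiv]
        simp only [hun, hDn, this, smul_apply, innerSL_apply_apply, smul_eq_mul]
        ring
      · simp [image_eq_zero_of_notMem_tsupport hx]
    · exact (hf'.mul hφc).integrable_of_hasCompactSupport hφs.mul_left
    · exact (hf.mul hdφc).integrable_of_hasCompactSupport hdφs.mul_left
    · exact (hf.mul hφc).integrable_of_hasCompactSupport hφs.mul_left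
    · exact fun x _ => (hder x).differentiableAt
    · exact fun x _ => hφ.differentiable (by simp) x
  have limL : Tendsto (fun n => ∫ x, G (un n x) * fderiv ℝ φ x y) atTop
      (𝓝 (∫ x, G (U x) * fderiv ℝ φ x y)) := by
    have hint : ∀ f : V → ℝ, Integrable f → Integrable (fun x => G (f x) * fderiv ℝ φ x y) := by
      intro f hf
      have h0 : Integrable (fun x => G 0 * fderiv ℝ φ x y) :=
        (hdφc.integrable_of_hasCompactSupport hdφs).const_mul _
      have h1 : Integrable (fun x => (G (f x) - G 0) * fderiv ℝ φ x y) := by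
        refine (hf.norm.const_mul (C * B')).mono' ?_ (.of_forall fun x => ?_)
        · exact ((hGc.comp_aestronglyMeasurable hf.aestronglyMeasurable).sub
            aestronglyMeasurable_const).mul hdφc.aestronglyMeasurable
        · rw [norm_mul, Real.norm_eq_abs]
          calc _ ≤ (C * |f x|) * B' := by
                have := hGlip (f x) 0
                rw [sub_zero] at this
                gcongr
                exact hB' x
            _ = _ := by rw [Real.norm_eq_abs]; ring
      exact (h0.add h1).congr (.of_forall fun x => by simp; ring)
    refine tendsto_iff_norm_sub_tendsto_zero.2 ?_
    refine squeeze_zero (fun _ => norm_nonneg _) (fun n => ?_)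
      (by simpa using (tendsto_integral_mollify_bump hm hu).const_mul (C * B'))
    rw [← integral_sub (hint _ (huni n)) (hint _ hUi), ← integral_const_mul]
    refine norm_integral_le_of_norm_le (((huni n).sub hUi).norm.const_mul _)
      (.of_forall fun x => ?_)
    rw [← sub_mul, norm_mul, Real.norm_eq_abs]
    calc _ ≤ (C * |un n x - U x|) * B' := by
          gcongr
          · exact hGlip _ _
          · exact hB' x
      _ = C * B' * ‖un n x - U x‖ := by rw [Real.norm_eq_abs]; ring
  have hG'm : ∀ f : V → ℝ, AEStronglyMeasurable f → AEStronglyMeasurable (fun x => φ x * G' (f x)) :=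
    fun f hf => hφc.aestronglyMeasurable.mul (hG'c.comp_aestronglyMeasurable hf)
  have hbd : ∀ (f : V → ℝ) x, ‖φ x * G' (f x)‖ ≤ B * C := fun f x => by
    rw [norm_mul, Real.norm_eq_abs (G' _)]
    exact mul_le_mul (hB x) (hC _) (abs_nonneg _) ((norm_nonneg _).trans (hB x))
  have hint2 : ∀ (f : V → ℝ) (w : V → V), Integrable f → Integrable w →
      Integrable (fun x => (φ x * G' (f x)) * inner ℝ (w x) y) := fun f w hf hw' =>
    (hw'.inner_const y).bdd_mul (hG'm f hf.aestronglyMeasurable) (.of_forall (hbd f))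
  -- Both factors depend on `n`. Here the gradients converge in `L¹` against bounded multipliers; in
  -- `limR2` the gradient is fixed and the multipliers converge a.e. under domination.
  have limR1 : Tendsto (fun n => ∫ x, (φ x * G' (un n x)) * inner ℝ (Dn n x - D x) y) atTop
      (𝓝 0) := by
    refine squeeze_zero_norm (fun n => ?_)
      (by simpa using (tendsto_integral_mollify_bump hm hDu).const_mul (B * C * ‖y‖))
    rw [← integral_const_mul]
    refine norm_integral_le_of_norm_le (((hDni n).sub hDi).norm.const_mul _)
      (.of_forall fun x => ?_)
    rw [norm_mul]
    calc _ ≤ (B * C) * (‖Dn n x - D x‖ * ‖y‖) := by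
          refine mul_le_mul (hbd _ x) (norm_inner_le_norm _ _) (norm_nonneg _)
            ((norm_nonneg _).trans (hbd (un n) x))
      _ = B * C * ‖y‖ * ‖Dn n x - D x‖ := by ring
  have limR2 : Tendsto (fun n => ∫ x, (φ x * G' (un n x)) * inner ℝ (D x) y) atTop
      (𝓝 (∫ x, (φ x * G' (U x)) * inner ℝ (D x) y)) := by
    refine tendsto_integral_of_dominated_convergence (fun x => (B * C) * ‖inner ℝ (D x) y‖)
      (fun n => (hint2 _ _ (huni n) hDi).aestronglyMeasurable)
      ((hDi.inner_const y).norm.const_mul _) (fun n => .of_forall fun x => ?_) ?_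
    · rw [norm_mul]
      exact mul_le_mul_of_nonneg_right (hbd _ _) (norm_nonneg _)
    · filter_upwards [ae_tendsto_mollify_bump hm hu] with x hx
      exact (((hG'c.tendsto _).comp hx).const_mul _).mul_const _
  have limR : Tendsto (fun n => ∫ x, φ x * (G' (un n x) * inner ℝ (Dn n x) y)) atTop
      (𝓝 (∫ x, φ x * (G' (U x) * inner ℝ (D x) y))) := by
    have := limR1.add limR2
    rw [zero_add] at this
    simp only [← mul_assoc]
    refine this.congr fun n => ?_
    rw [← integral_add]
    · refine integral_congr_ae (.of_forall fun x => ?_)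
      simp only [inner_sub_left]
      ring
    · exact hint2 _ _ (huni n) ((hDni n).sub hDi)
    · exact hint2 _ _ (huni n) hDi
  exact tendsto_nhds_unique (limL.congr' hstep) limR.neg

end WeakDerivative

/-- A function with vanishing weak gradient on a connected open set is constant. -/
theorem ae_eq_const_of_weak_grad_eq_zero {V : Type*} [NormedAddCommGroup V]
    [InnerProductSpace ℝ V] [FiniteDimensional ℝ V] [MeasureSpace V] [BorelSpace V]
    [(volume : Measure V).IsAddHaarMeasure] {Ω : Set V} {u : V → ℝ} {Du : V → V}
    (hΩ : IsOpen Ω) (hconn : IsConnected Ω)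
    (hu : IntegrableOn u Ω) (hDu : IntegrableOn Du Ω)
    (hw : HasWeakFDeriv Ω u (fun x => innerSL ℝ (Du x)))
    (hzero : ∀ᵐ x ∂volume.restrict Ω, Du x = 0) :
    ∃ k, ∀ᵐ x ∂volume.restrict Ω, u x = k := by
  have hm := hΩ.measurableSet
  have hD0 : Ω.indicator Du =ᵐ[volume] 0 := by
    rw [ae_restrict_iff' hm] at hzero
    filter_upwards [hzero] with x hx
    by_cases h : x ∈ Ω <;> simp [h, hx]
  have hmoll0 : ∀ b x, mollify b Ω Du x = 0 := fun b x => by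
    rw [mollify, convolution_congr _ (EventuallyEq.refl _ _) hD0]
    simp
  -- On a ball of half the radius, mollifications of small width have zero classical gradient and
  -- are constant. Their a.e. limit `u` inherits this.
  have hloc : ∀ x ∈ Ω, ∃ r > 0, Metric.ball x r ⊆ Ω ∧
      ∃ k, ∀ᵐ z, z ∈ Metric.ball x r → u z = k := by
    intro x hx
    obtain ⟨r, hr, hrΩ⟩ := Metric.isOpen_iff.1 hΩ x hx
    refine ⟨r / 2, by positivity, (Metric.ball_subset_ball (by linarith)).trans hrΩ, ?_⟩
    have hconst : ∀ᶠ n in atTop, ∀ z ∈ Metric.ball x (r / 2), ∀ z' ∈ Metric.ball x (r / 2),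
        mollify (bump V n) Ω u z = mollify (bump V n) Ω u z' := by
      filter_upwards [(tendsto_rOut_bump V).eventually (gt_mem_nhds (half_pos hr))] with n hn z hz z' hz'
      refine Convex.is_const_of_fderivWithin_eq_zero (𝕜 := ℝ) (convex_ball x (r / 2))
        ((contDiff_mollify hm hu _).differentiable (by simp)).differentiableOn ?_ hz hz'
      intro w hw'
      have hsub : Metric.closedBall w (bump V n).rOut ⊆ Ω := by
        refine Subset.trans (fun q hq => ?_) hrΩ
        rw [Metric.mem_ball] at hw' ⊢
        rw [Metric.mem_closedBall] at hq
        linarith [dist_triangle q w x]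
      have := hasFDerivAt_mollify hm hu hDu hw (bump V n) hsub
      rw [hmoll0, map_zero] at this
      rw [fderivWithin_of_isOpen Metric.isOpen_ball hw', this.fderiv]
    have hae := ae_tendsto_mollify_bump hm hu
    have hpos : (volume (Metric.ball x (r / 2))) ≠ 0 :=
      (Metric.measure_ball_pos _ _ (by positivity)).ne'
    obtain ⟨z₀, hz₀, hlim₀⟩ : ∃ z₀ ∈ Metric.ball x (r / 2),
        Tendsto (fun n => mollify (bump V n) Ω u z₀) atTop (𝓝 (Ω.indicator u z₀)) := by
      by_contra! hcon
      refine hpos (measure_mono_null (fun z hz => ?_) hae)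
      exact hcon z hz
    refine ⟨u z₀, ?_⟩
    have hsubΩ : Metric.ball x (r / 2) ⊆ Ω := (Metric.ball_subset_ball (by linarith)).trans hrΩ
    filter_upwards [hae] with z hz hzb
    rw [indicator_of_mem (hsubΩ hzb)] at hz
    rw [indicator_of_mem (hsubΩ hz₀)] at hlim₀
    refine tendsto_nhds_unique hz (hlim₀.congr' ?_)
    filter_upwards [hconst] with n hn
    exact hn z₀ hz₀ z hzb
  choose! r hr hrΩ K hK using hloc
  -- Overlapping balls meet in a nonempty open set, which has positive measure, so their constants
  -- agree. Connectedness propagates the equality over `Ω`.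
  have hKeq : ∀ x ∈ Ω, ∀ y ∈ Ω, K x = K y := by
    intro x hx y hy
    refine hconn.isPreconnected.induction₂ (fun x y => K x = K y) (fun x hx => ?_)
      (fun _ _ _ _ _ _ => Eq.trans) (fun _ _ _ _ => Eq.symm) hx hy
    filter_upwards [mem_nhdsWithin_of_mem_nhds (Metric.ball_mem_nhds x (hr x hx)),
      self_mem_nhdsWithin] with y hy hyΩ
    by_contra hne
    have hopen : IsOpen (Metric.ball x (r x) ∩ Metric.ball y (r y)) :=
      Metric.isOpen_ball.inter Metric.isOpen_ball
    have hpos := (hopen.measure_pos volume ⟨y, hy, Metric.mem_ball_self (hr y hyΩ)⟩).ne'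
    refine hpos (measure_mono_null (fun z hz => ?_) ((hK x hx).and (hK y hyΩ)))
    rintro ⟨h1, h2⟩
    exact hne ((h1 hz.1).symm.trans (h2 hz.2))
  obtain ⟨x₀, hx₀⟩ := hconn.nonempty
  refine ⟨K x₀, ?_⟩
  rw [ae_restrict_iff' hm, ae_iff]
  refine measure_null_of_locally_null _ fun x hx => ?_
  simp only [Classical.not_imp, mem_ofPred_eq] at hx
  refine ⟨_ ∩ _, inter_mem (mem_nhdsWithin_of_mem_nhds (Metric.ball_mem_nhds x (hr x hx.1)))
    self_mem_nhdsWithin, measure_mono_null (fun z hz => ?_) (hK x hx.1)⟩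
  simp only [Classical.not_imp, mem_ofPred_eq, mem_inter_iff, mem_compl_iff] at hz ⊢
  exact ⟨hz.1, by rw [hKeq x hx.1 x₀ hx₀]; exact hz.2.2⟩

/-! ### Chain rule and level sets in `H¹(Ω)`. -/

section SobolevCalculus

variable {Ω : Set E3} {u : E3 → ℝ} {Du : E3 → E3}

/-- Composition with a Lipschitz `C¹` function preserves `L²` of a finite measure. -/
theorem memLp_comp_of_hasDerivAt {α : Type*} [MeasurableSpace α] {μ : Measure α}
    [IsFiniteMeasure μ] {f : α → ℝ} {p : ℝ≥0∞} (hf : MemLp f p μ) {G G' : ℝ → ℝ} {C : ℝ}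
    (hG : ∀ s, HasDerivAt G (G' s) s) (hC : ∀ s, |G' s| ≤ C) :
    MemLp (fun x => G (f x)) p μ := by
  have h1 : MemLp (fun x => |G 0| + C * |f x|) p μ :=
    (memLp_const (|G 0|)).add (MemLp.const_mul (f := fun x => |f x|) hf.norm C)
  refine h1.mono' ((continuous_of_hasDerivAt hG).comp_aestronglyMeasurable
    hf.aestronglyMeasurable) (.of_forall fun x => ?_)
  have := abs_sub_le_of_hasDerivAt hG hC (f x) 0
  rw [sub_zero] at this
  rw [Real.norm_eq_abs]
  calc |G (f x)| = |G 0 + (G (f x) - G 0)| := by ring_nf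
    _ ≤ |G 0| + |G (f x) - G 0| := abs_add_le _ _
    _ ≤ _ := by gcongr

theorem memLp_smul_of_bounded {α : Type*} [MeasurableSpace α] {μ : Measure α}
    {f : α → ℝ} {g : α → E3} {p : ℝ≥0∞} (hf : AEStronglyMeasurable f μ) {C : ℝ}
    (hC : ∀ x, |f x| ≤ C) (hg : MemLp g p μ) : MemLp (fun x => f x • g x) p μ := by
  refine hg.of_le_mul (c := C) (hf.smul hg.aestronglyMeasurable) (.of_forall fun x => ?_)
  rw [norm_smul, Real.norm_eq_abs]
  exact mul_le_mul_of_nonneg_right (hC x) (norm_nonneg _)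

theorem IsH1.integrableOn (hfin : volume Ω ≠ ⊤) (h : IsH1 Ω u Du) : IntegrableOn u Ω :=
  have : IsFiniteMeasure (volume.restrict Ω) := ⟨by simpa using hfin.lt_top⟩
  h.memLp.integrable (by norm_num)

theorem IsH1.integrableOn_grad (hfin : volume Ω ≠ ⊤) (h : IsH1 Ω u Du) : IntegrableOn Du Ω :=
  have : IsFiniteMeasure (volume.restrict Ω) := ⟨by simpa using hfin.lt_top⟩
  h.memLp_grad.integrable (by norm_num)

/-- Chain rule in `H¹`. -/
theorem IsH1.comp_real (hΩ : IsOpen Ω) (hfin : volume Ω ≠ ⊤) (h : IsH1 Ω u Du) {G G' : ℝ → ℝ}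
    {C : ℝ} (hG : ∀ s, HasDerivAt G (G' s) s) (hG'c : Continuous G') (hC : ∀ s, |G' s| ≤ C) :
    IsH1 Ω (fun x => G (u x)) (fun x => G' (u x) • Du x) where
  memLp :=
    have : IsFiniteMeasure (volume.restrict Ω) := ⟨by simpa using hfin.lt_top⟩
    memLp_comp_of_hasDerivAt h.memLp hG hC
  memLp_grad := memLp_smul_of_bounded
    (hG'c.comp_aestronglyMeasurable h.memLp.aestronglyMeasurable) (fun x => hC _) h.memLp_grad
  weak := h.weak.comp_real hΩ (h.integrableOn hfin) (h.integrableOn_grad hfin) hG hG'c hC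

/-- The weak gradient vanishes almost everywhere on level sets. -/
theorem IsH1.grad_eq_zero_of_eq (hΩ : IsOpen Ω) (hfin : volume Ω ≠ ⊤) (h : IsH1 Ω u Du) (k : ℝ) :
    ∀ᵐ x ∂volume.restrict Ω, u x = k → Du x = 0 := by
  have hm := hΩ.measurableSet
  set a : ℕ → ℝ := fun n => (n : ℝ) + 1
  have ha : ∀ n, 0 < a n := fun n => by positivity
  -- `G n` tends to zero uniformly while `G' n` is bounded by one and tends pointwise to the
  -- indicator of `{k}`. The limit of the weak formulation says that `Du`, cut off to the level set,
  -- integrates to zero against every test function.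
  set G : ℕ → ℝ → ℝ := fun n s => (a n)⁻¹ * Real.arctan (a n * (s - k))
  set G' : ℕ → ℝ → ℝ := fun n s => (1 + (a n * (s - k)) ^ 2)⁻¹
  have hG : ∀ n s, HasDerivAt (G n) (G' n s) s := fun n s => by
    have h1 : HasDerivAt (fun s => a n * (s - k)) (a n) s := by
      simpa using ((hasDerivAt_id s).sub_const k).const_mul (a n)
    have h2 := (h1.arctan).const_mul (a n)⁻¹
    refine h2.congr_deriv ?_
    simp only [G', one_div]
    field_simp [(ha n).ne']
  have hG'c : ∀ n, Continuous (G' n) := fun n => by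
    refine Continuous.inv₀ (by fun_prop) fun s => by positivity
  have hG'0 : ∀ n s, 0 ≤ G' n s := fun n s => by positivity
  have hG'1 : ∀ n s, |G' n s| ≤ 1 := fun n s => by
    rw [abs_of_nonneg (hG'0 n s)]
    exact inv_le_one_of_one_le₀ (le_add_of_nonneg_right (sq_nonneg _))
  have hGb : ∀ n s, |G n s| ≤ (a n)⁻¹ * (Real.pi / 2) := fun n s => by
    rw [abs_mul, abs_of_pos (inv_pos.2 (ha n))]
    refine mul_le_mul_of_nonneg_left ?_ (inv_pos.2 (ha n)).le
    exact abs_le.2 ⟨(Real.neg_pi_div_two_lt_arctan _).le, (Real.arctan_lt_pi_div_two _).le⟩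
  have hainf : Tendsto a atTop atTop :=
    tendsto_atTop_add_const_right _ _ tendsto_natCast_atTop_atTop
  have hlim : ∀ x, Tendsto (fun n => G' n (u x) • Du x) atTop
      (𝓝 ({x | u x = k}.indicator Du x)) := by
    intro x
    by_cases hx : u x = k
    · have : ∀ n, G' n (u x) • Du x = Du x := fun n => by simp [G', hx]
      simp only [this]
      rw [indicator_of_mem (by exact hx)]
      exact tendsto_const_nhds
    · rw [indicator_of_notMem (by exact hx), ← zero_smul ℝ (Du x)]
      refine Tendsto.smul_const ?_ _
      have hne : 0 < (u x - k) ^ 2 := by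
        have : u x - k ≠ 0 := sub_ne_zero.2 hx
        positivity
      refine tendsto_inv_atTop_zero.comp (tendsto_atTop_add_const_left _ _ ?_)
      have : (fun n => (a n * (u x - k)) ^ 2) = fun n => (a n) ^ 2 * (u x - k) ^ 2 := by
        ext n; ring
      rw [this]
      exact ((tendsto_pow_atTop two_ne_zero).comp hainf).atTop_mul_const hne
  have hui := h.integrableOn hfin
  have hDi := h.integrableOn_grad hfin
  have hmeas : ∀ n, AEStronglyMeasurable (fun x => G' n (u x) • Du x) (volume.restrict Ω) :=
    fun n => ((hG'c n).comp_aestronglyMeasurable hui.aestronglyMeasurable).smul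
      hDi.aestronglyMeasurable
  have hmeasI : AEStronglyMeasurable ({x | u x = k}.indicator Du) (volume.restrict Ω) :=
    aestronglyMeasurable_of_tendsto_ae atTop hmeas (.of_forall hlim)
  have hIi : IntegrableOn ({x | u x = k}.indicator Du) Ω :=
    hDi.norm.mono' hmeasI (.of_forall fun x => norm_indicator_le_norm_self _ _)
  have hzero := hΩ.ae_eq_zero_of_integral_contDiff_smul_eq_zero hIi.locallyIntegrableOn ?_
  · rw [ae_restrict_iff' hm]
    filter_upwards [hzero] with x hx hxΩ hk
    have := hx hxΩ
    rwa [indicator_of_mem (by exact hk)] at this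
  intro φ hφ hφs hφΩ
  have hφ0 : ∀ x, x ∉ Ω → φ x = 0 := fun x hx =>
    image_eq_zero_of_notMem_tsupport fun h => hx (hφΩ h)
  rw [← setIntegral_eq_integral_of_forall_compl_eq_zero (s := Ω) fun x hx => by simp [hφ0 x hx]]
  obtain ⟨B, hB⟩ := hφs.exists_bound_of_continuous hφ.continuous
  have hφi : IntegrableOn (fun x => φ x • {x | u x = k}.indicator Du x) Ω :=
    hIi.bdd_smul B hφ.continuous.aestronglyMeasurable (.of_forall hB)
  refine ext_inner_right ℝ fun y => ?_
  rw [inner_zero_left, real_inner_comm, ← integral_inner hφi]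
  have hweak : ∀ n, ∫ x in Ω, G n (u x) * fderiv ℝ φ x y
      = -∫ x in Ω, φ x * inner ℝ (G' n (u x) • Du x) y := fun n =>
    (h.weak.comp_real hΩ hui hDi (hG n) (hG'c n) (hG'1 n)) φ hφ hφs hφΩ y
  have hdφc : Continuous (fun x => fderiv ℝ φ x y) := by
    have := hφ.continuous_fderiv (by simp)
    fun_prop
  have hdφs : HasCompactSupport (fun x => fderiv ℝ φ x y) :=
    (hφs.fderiv ℝ).comp_left (g := fun L : E3 →L[ℝ] ℝ => L y) rfl
  have hdi : Integrable (fun x => fderiv ℝ φ x y) (volume.restrict Ω) :=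
    (hdφc.integrable_of_hasCompactSupport hdφs).integrableOn
  have hL : Tendsto (fun n => ∫ x in Ω, G n (u x) * fderiv ℝ φ x y) atTop (𝓝 0) := by
    have h0 : Tendsto (fun n => (a n)⁻¹ * (Real.pi / 2) * ∫ x in Ω, ‖fderiv ℝ φ x y‖) atTop
        (𝓝 0) := by
      have := ((tendsto_inv_atTop_zero.comp hainf).mul_const (Real.pi / 2)).mul_const
        (∫ x in Ω, ‖fderiv ℝ φ x y‖)
      simpa using this
    refine squeeze_zero_norm (fun n => ?_) h0
    rw [← integral_const_mul]
    refine norm_integral_le_of_norm_le (hdi.norm.const_mul _) (.of_forall fun x => ?_)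
    rw [norm_mul]
    exact mul_le_mul_of_nonneg_right (hGb n _) (norm_nonneg _)
  have hR : Tendsto (fun n => ∫ x in Ω, φ x * inner ℝ (G' n (u x) • Du x) y) atTop
      (𝓝 (∫ x in Ω, φ x * inner ℝ ({x | u x = k}.indicator Du x) y)) := by
    refine tendsto_integral_of_dominated_convergence (fun x => B * (‖Du x‖ * ‖y‖))
      (fun n => ?_) ((hDi.norm.mul_const _).const_mul _) (fun n => .of_forall fun x => ?_)
      (.of_forall fun x => ?_)
    · exact hφ.continuous.aestronglyMeasurable.mul ((hmeas n).inner aestronglyMeasurable_const)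
    · rw [norm_mul]
      refine mul_le_mul (hB x) ((norm_inner_le_norm _ _).trans ?_) (norm_nonneg _)
        ((norm_nonneg _).trans (hB x))
      refine mul_le_mul_of_nonneg_right ?_ (norm_nonneg _)
      rw [norm_smul, Real.norm_eq_abs]
      exact mul_le_of_le_one_left (norm_nonneg _) (hG'1 n _)
    · exact ((hlim x).inner tendsto_const_nhds).const_mul _
  have := tendsto_nhds_unique hL (by simpa only [hweak] using hR.neg)
  rw [eq_comm, neg_eq_zero] at this
  rw [← this]
  refine integral_congr_ae (.of_forall fun x => ?_)
  simp only
  rw [real_inner_smul_right, real_inner_comm]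

end SobolevCalculus

/-! ### Distributional derivatives in time -/

/-- A continuous function on `[0,T]` whose distributional derivative is the integrable function
`-q` is a primitive of `-q`. -/
theorem sub_eq_neg_integral_of_timeTest {T : ℝ} (hT : 0 < T) {m q : ℝ → ℝ}
    (hm : ContinuousOn m (Icc 0 T)) (hq : IntegrableOn q (Ioo 0 T))
    (h : ∀ ζ, IsTimeTest T ζ →
      -(∫ t in Ioo 0 T, deriv ζ t * m t) + ∫ t in Ioo 0 T, ζ t * q t = 0)
    {a b : ℝ} (ha : a ∈ Icc 0 T) (hb : b ∈ Icc 0 T) : m b - m a = -∫ t in a..b, q t := by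
  have hqI : IntervalIntegrable q volume 0 T :=
    (intervalIntegrable_iff_integrableOn_Ioo_of_le hT.le).2 hq
  set Q : ℝ → ℝ := fun t => ∫ s in (0 : ℝ)..t, q s with hQ
  have hQac : AbsolutelyContinuousOnInterval Q 0 T :=
    hqI.absolutelyContinuousOnInterval_intervalIntegral (c := 0) (by simp)
  have hQc : ContinuousOn Q (Icc 0 T) := by
    have := hQac.continuousOn
    rwa [uIcc_of_le hT.le] at this
  -- `M` has zero distributional derivative, by integration by parts for the absolutely continuous
  -- `Q`; hence it is a.e. constant.
  set M : ℝ → ℝ := fun t => m t + Q t with hM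
  have hMc : ContinuousOn M (Icc 0 T) := hm.add hQc
  have hMi : IntegrableOn M (Ioo 0 T) :=
    (hMc.integrableOn_compact isCompact_Icc).mono_set Ioo_subset_Icc_self
  have hzero : ∀ ζ, IsTimeTest T ζ → ∫ t in Ioo 0 T, M t * deriv ζ t = 0 := by
    intro ζ hζ
    obtain ⟨hζc, hζs, hζT⟩ := hζ
    have hζ0 : ζ 0 = 0 := image_eq_zero_of_notMem_tsupport fun h => (hζT h).1.false
    have hζ1 : ζ T = 0 := image_eq_zero_of_notMem_tsupport fun h => (hζT h).2.false
    have hζac : AbsolutelyContinuousOnInterval ζ 0 T :=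
      (hζc.of_le (by simp)).contDiffOn.absolutelyContinuousOnInterval
    have hdc : Continuous (deriv ζ) := hζc.continuous_deriv (by simp)
    have ibp := hQac.integral_mul_deriv_eq_deriv_mul hζac
    rw [hζ0, hζ1, mul_zero, mul_zero, sub_zero, zero_sub] at ibp
    have hd : ∫ x in (0 : ℝ)..T, deriv Q x * ζ x = ∫ x in (0 : ℝ)..T, ζ x * q x := by
      refine intervalIntegral.integral_congr_ae ?_
      filter_upwards [hqI.ae_hasDerivAt_integral] with x hx hxI
      rw [(hx (uIoc_subset_uIcc hxI) 0 (by simp)).deriv, mul_comm]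
    rw [hd, intervalIntegral.integral_of_le hT.le, intervalIntegral.integral_of_le hT.le,
      integral_Ioc_eq_integral_Ioo, integral_Ioc_eq_integral_Ioo] at ibp
    have hi1 : IntegrableOn (fun t => m t * deriv ζ t) (Ioo 0 T) :=
      ((hm.mul hdc.continuousOn).integrableOn_compact isCompact_Icc).mono_set Ioo_subset_Icc_self
    have hi2 : IntegrableOn (fun t => Q t * deriv ζ t) (Ioo 0 T) :=
      ((hQc.mul hdc.continuousOn).integrableOn_compact isCompact_Icc).mono_set Ioo_subset_Icc_self
    have hsum : ∫ t in Ioo 0 T, M t * deriv ζ t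
        = (∫ t in Ioo 0 T, deriv ζ t * m t) + ∫ t in Ioo 0 T, Q t * deriv ζ t := by
      rw [← integral_congr_ae (.of_forall fun t => mul_comm (m t) (deriv ζ t)),
        ← integral_add hi1 hi2]
      exact integral_congr_ae (.of_forall fun t => add_mul _ _ _)
    have := h ζ ⟨hζc, hζs, hζT⟩
    rw [hsum, ibp]
    linarith
  obtain ⟨k, hk⟩ := ae_eq_const_of_weak_grad_eq_zero (Ω := Ioo 0 T) (u := M) (Du := fun _ => 0)
    isOpen_Ioo (isConnected_Ioo hT) hMi (integrable_zero _ _ _) (fun ζ hζ hζs hζT y => by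
      have e : ∀ x, M x * fderiv ℝ ζ x y = (M x * deriv ζ x) * y := fun x => by
        rw [← toSpanSingleton_deriv, ContinuousLinearMap.toSpanSingleton_apply, smul_eq_mul]; ring
      simp only [e, integral_mul_const, hzero ζ ⟨hζ, hζs, hζT⟩]
      simp) (.of_forall fun _ => rfl)
  -- Continuity upgrades this to every time, including both endpoints, where the periodicity
  -- conditions are imposed.
  have hkIcc : ∀ t ∈ Icc 0 T, M t = k := by
    have := Measure.eqOn_of_ae_eq (μ := volume) (f := M) (g := fun _ => k) (s := Icc 0 T)
      (by rwa [← restrict_Ioo_eq_restrict_Icc]) hMc continuousOn_const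
      (by rw [interior_Icc, closure_Ioo hT.ne])
    exact this
  have hab : Q b - Q a = ∫ t in a..b, q t := by
    refine intervalIntegral.integral_interval_sub_left (hqI.mono_set ?_) (hqI.mono_set ?_)
    · rw [uIcc_of_le hT.le, uIcc_of_le hb.1]; exact Icc_subset_Icc_right hb.2
    · rw [uIcc_of_le hT.le, uIcc_of_le ha.1]; exact Icc_subset_Icc_right ha.2
  have h1 := hkIcc a ha
  have h2 := hkIcc b hb
  simp only [hM] at h1 h2
  linarith

/-! ### Time translations of space-time functions -/

theorem integrable_inner_of_memLp {α : Type*} [MeasurableSpace α] {μ : Measure α} {f g : α → E3}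
    (hf : MemLp f 2 μ) (hg : MemLp g 2 μ) : Integrable (fun x => inner ℝ (f x) (g x)) μ := by
  refine (hf.norm.integrable_mul hg.norm).mono'
    (hf.aestronglyMeasurable.inner hg.aestronglyMeasurable) (.of_forall fun x => ?_)
  exact norm_inner_le_norm _ _

theorem norm_integral_inner_le {α : Type*} [MeasurableSpace α] {μ : Measure α} {f g : α → E3}
    (hf : MemLp f 2 μ) (hg : MemLp g 2 μ) :
    ‖∫ x, inner ℝ (f x) (g x) ∂μ‖ ≤ (eLpNorm f 2 μ).toReal * (eLpNorm g 2 μ).toReal := by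
  have := norm_inner_le_norm (𝕜 := ℝ) (hf.toLp f) (hg.toLp g)
  rw [L2.inner_def, Lp.norm_toLp, Lp.norm_toLp] at this
  refine le_trans (le_of_eq ?_) this
  congr 1
  refine integral_congr_ae ?_
  filter_upwards [hf.coeFn_toLp, hg.coeFn_toLp] with x h1 h2
  rw [h1, h2]

instance : (volume : Measure (ℝ × E3)).IsAddHaarMeasure :=
  inferInstanceAs ((volume : Measure ℝ).prod (volume : Measure E3)).IsAddHaarMeasure

theorem measurePreserving_time_shift (σ : ℝ) :
    MeasurePreserving (fun p : ℝ × E3 => (p.1 - σ, p.2)) := by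
  have h := measurePreserving_sub_right (volume : Measure (ℝ × E3)) (σ, 0)
  have e : (fun p : ℝ × E3 => (p.1 - σ, p.2)) = fun p => p - (σ, 0) := by
    ext p <;> simp
  rwa [e]

/-- The shear makes shifted functions jointly measurable and integrable in the shift and the point,
so that integrals over shift and time can be exchanged. -/
theorem measurePreserving_time_shift_prod (ν : Measure ℝ) [SFinite ν] :
    MeasurePreserving (fun p : ℝ × (ℝ × E3) => (p.1, (p.2.1 - p.1, p.2.2)))
      (ν.prod volume) (ν.prod volume) :=
  (MeasurePreserving.id ν).skew_product (g := fun σ (p : ℝ × E3) => (p.1 - σ, p.2))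
    (by unfold Function.uncurry; fun_prop)
    (.of_forall fun σ => (measurePreserving_time_shift σ).map_eq)

section TimeShift

variable {A B : ℝ × E3 → E3} {F g : ℝ × E3 → ℝ} (κ : ℝ)

/-- The space-time integrand pairing a flux at time `t - σ` with a test function at time `t`. -/
def shiftPairing (κ : ℝ) (A B : ℝ × E3 → E3) (F g : ℝ × E3 → ℝ) (σ : ℝ) (p : ℝ × E3) : ℝ :=
  κ * inner ℝ (A (p.1 - σ, p.2)) (B p) + F (p.1 - σ, p.2) * g p

theorem integrable_shiftPairing (hA : MemLp A 2) (hB : MemLp B 2) (hF : Integrable F)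
    (hg : AEStronglyMeasurable g) (hg1 : ∀ p, |g p| ≤ 1) (ν : Measure ℝ) [IsFiniteMeasure ν] :
    Integrable (fun p : ℝ × (ℝ × E3) => shiftPairing κ A B F g p.1 p.2) (ν.prod volume) := by
  have hmp := measurePreserving_time_shift_prod ν
  have hA' : MemLp (fun p : ℝ × (ℝ × E3) => A (p.2.1 - p.1, p.2.2)) 2 (ν.prod volume) :=
    (hA.comp_snd ν).comp_measurePreserving hmp
  have hF' : Integrable (fun p : ℝ × (ℝ × E3) => F (p.2.1 - p.1, p.2.2)) (ν.prod volume) :=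
    hmp.integrable_comp_of_integrable (hF.comp_snd ν)
  refine ((integrable_inner_of_memLp hA' (hB.comp_snd ν)).const_mul κ).add ?_
  exact hF'.mul_bdd (c := 1) hg.comp_snd (.of_forall fun p => hg1 _)

/-- Only `A` and `F` are shifted, so continuity of translations in `L²` for `A` and in `L¹` for `F`
suffices. An `F` that is merely integrable is affordable because `g` is bounded. -/
theorem tendsto_integral_shiftPairing (hA : MemLp A 2) (hB : MemLp B 2) (hF : Integrable F)
    (hg : AEStronglyMeasurable g) (hg1 : ∀ p, |g p| ≤ 1) :
    Tendsto (fun σ => ∫ p, shiftPairing κ A B F g σ p) (𝓝 0)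
      (𝓝 (∫ p, shiftPairing κ A B F g 0 p)) := by
  have hτ : Tendsto (fun σ : ℝ => ((σ, 0) : ℝ × E3)) (𝓝 0) (𝓝 0) := by
    have : Continuous (fun σ : ℝ => ((σ, 0) : ℝ × E3)) := by fun_prop
    exact this.tendsto 0
  have htrA := (tendsto_eLpNorm_translate_sub (by norm_num) (by norm_num) hA).comp hτ
  have htrF := (tendsto_eLpNorm_translate_sub le_rfl ENNReal.one_ne_top
    (memLp_one_iff_integrable.2 hF)).comp hτ
  have hAσ : ∀ σ : ℝ, MemLp (fun p : ℝ × E3 => A (p.1 - σ, p.2)) 2 := fun σ =>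
    hA.comp_measurePreserving (measurePreserving_time_shift σ)
  have hFσ : ∀ σ : ℝ, Integrable (fun p : ℝ × E3 => F (p.1 - σ, p.2)) := fun σ =>
    (measurePreserving_time_shift σ).integrable_comp_of_integrable hF
  have hshift : ∀ (p : ℝ × E3) σ, p - ((σ, 0) : ℝ × E3) = (p.1 - σ, p.2) := fun p σ => by
    ext <;> simp
  have hJi : ∀ σ, Integrable (shiftPairing κ A B F g σ) := fun σ =>
    ((integrable_inner_of_memLp (hAσ σ) hB).const_mul κ).add
      ((hFσ σ).mul_bdd (c := 1) hg (.of_forall hg1))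
  refine tendsto_iff_norm_sub_tendsto_zero.2 ?_
  have hlim : Tendsto (fun σ : ℝ =>
      |κ| * ((eLpNorm (fun p => A (p - ((σ, 0) : ℝ × E3)) - A p) 2 volume).toReal
        * (eLpNorm B 2 volume).toReal)
      + (eLpNorm (fun p => F (p - ((σ, 0) : ℝ × E3)) - F p) 1 volume).toReal) (𝓝 0) (𝓝 0) := by
    have h1 := (ENNReal.tendsto_toReal ENNReal.zero_ne_top).comp htrA
    have h2 := (ENNReal.tendsto_toReal ENNReal.zero_ne_top).comp htrF
    simpa using ((h1.mul_const (eLpNorm B 2 volume).toReal).const_mul |κ|).add h2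
  refine squeeze_zero (fun _ => norm_nonneg _) (fun σ => ?_) hlim
  rw [← integral_sub (hJi σ) (hJi 0)]
  simp only [hshift]
  have hdA : MemLp (fun p : ℝ × E3 => A (p.1 - σ, p.2) - A p) 2 := (hAσ σ).sub hA
  have hdF : Integrable (fun p : ℝ × E3 => F (p.1 - σ, p.2) - F p) := (hFσ σ).sub hF
  have hsplit : ∫ p, (shiftPairing κ A B F g σ p - shiftPairing κ A B F g 0 p)
      = κ * (∫ p, inner ℝ (A (p.1 - σ, p.2) - A p) (B p))
        + ∫ p, (F (p.1 - σ, p.2) - F p) * g p := by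
    rw [← integral_const_mul, ← integral_add
      ((integrable_inner_of_memLp hdA hB).const_mul κ) (hdF.mul_bdd (c := 1) hg (.of_forall hg1))]
    refine integral_congr_ae (.of_forall fun p => ?_)
    simp only [shiftPairing, sub_zero, inner_sub_left]
    ring
  rw [hsplit]
  refine (norm_add_le _ _).trans (add_le_add ?_ ?_)
  · rw [norm_mul, Real.norm_eq_abs]
    exact mul_le_mul_of_nonneg_left (norm_integral_inner_le hdA hB) (abs_nonneg _)
  · rw [eLpNorm_one_eq_lintegral_enorm, ← integral_norm_eq_lintegral_enorm hdF.aestronglyMeasurable]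
    refine norm_integral_le_of_norm_le hdF.norm (.of_forall fun p => ?_)
    rw [norm_mul]
    exact mul_le_of_le_one_right (norm_nonneg _) (hg1 p)

end TimeShift

/-! ### The energy inequality for truncations -/

/-- `Φ` is a convex `C²` function with bounded first and second derivatives `G` and `G'`. -/
structure IsTruncation (Φ G G' : ℝ → ℝ) (C : ℝ) : Prop where
  hasDerivAt : ∀ s, HasDerivAt Φ (G s) s
  hasDerivAt' : ∀ s, HasDerivAt G (G' s) s
  continuous : Continuous G'
  abs_le_one : ∀ s, |G s| ≤ 1
  nonneg : ∀ s, 0 ≤ G' s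
  le : ∀ s, G' s ≤ C

namespace IsTruncation

variable {Φ G G' : ℝ → ℝ} {C : ℝ}

theorem abs_le (h : IsTruncation Φ G G' C) (s : ℝ) : |G' s| ≤ C := by
  rw [abs_of_nonneg (h.nonneg s)]; exact h.le s

theorem continuous_deriv (h : IsTruncation Φ G G' C) : Continuous G :=
  continuous_of_hasDerivAt h.hasDerivAt'

/-- The tangent inequality of a convex function. It takes the place of differentiating `Φ(u)` in
time. -/
theorem sub_le (h : IsTruncation Φ G G' C) (a b : ℝ) : Φ a - Φ b ≤ G a * (a - b) := by
  have hmono : Monotone G := monotone_of_deriv_nonneg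
    (fun s => (h.hasDerivAt' s).differentiableAt) fun s => by
      rw [(h.hasDerivAt' s).deriv]; exact h.nonneg s
  have hc : Continuous Φ := continuous_of_hasDerivAt h.hasDerivAt
  rcases lt_trichotomy a b with hab | rfl | hab
  · obtain ⟨ξ, hξ, he⟩ := exists_hasDerivAt_eq_slope Φ G hab hc.continuousOn
      fun s _ => h.hasDerivAt s
    rw [eq_div_iff (sub_pos.2 hab).ne'] at he
    nlinarith [hmono hξ.1.le, sub_pos.2 hab]
  · simp
  · obtain ⟨ξ, hξ, he⟩ := exists_hasDerivAt_eq_slope Φ G hab hc.continuousOn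
      fun s _ => h.hasDerivAt s
    rw [eq_div_iff (sub_pos.2 hab).ne'] at he
    nlinarith [hmono hξ.2.le, sub_pos.2 hab]

end IsTruncation

theorem cylinder_eq_restrict (Ω : Set E3) (T : ℝ) :
    cylinder Ω T = volume.restrict (Ioo 0 T ×ˢ Ω) := by
  rw [cylinder, Measure.prod_restrict, Measure.volume_eq_prod]

theorem cylinder_mono (Ω : Set E3) {s T : ℝ} (h : s ≤ T) : cylinder Ω s ≤ cylinder Ω T := by
  rw [cylinder_eq_restrict, cylinder_eq_restrict]
  exact Measure.restrict_mono (prod_mono (Ioo_subset_Ioo_right h) subset_rfl) le_rfl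

/-- A function with nonpositive integrals over `(0,h)` for all small `h` has a nonpositive
limit at `0`. -/
theorem le_zero_of_integral_le_zero {W : ℝ → ℝ} {w δ : ℝ} (hδ : 0 < δ)
    (hW : Tendsto W (𝓝[>] 0) (𝓝 w))
    (hi : ∀ h, 0 < h → h < δ → IntervalIntegrable W volume 0 h)
    (hle : ∀ h, 0 < h → h < δ → ∫ σ in (0 : ℝ)..h, W σ ≤ 0) : w ≤ 0 := by
  by_contra! hw
  have hev : ∀ᶠ σ in 𝓝[>] (0 : ℝ), w / 2 < W σ := hW.eventually (lt_mem_nhds (by linarith))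
  obtain ⟨r, hr, hsub⟩ := mem_nhdsGT_iff_exists_Ioo_subset.1 hev
  have hr : 0 < r := hr
  set h := min r δ / 2 with hh
  have hm : 0 < min r δ := lt_min hr hδ
  have h0 : 0 < h := half_pos hm
  have hr' : h < r := (half_lt_self hm).trans_le (min_le_left _ _)
  have hδ' : h < δ := (half_lt_self hm).trans_le (min_le_right _ _)
  have hge : ∫ _ in (0 : ℝ)..h, w / 2 ≤ ∫ σ in (0 : ℝ)..h, W σ := by
    refine intervalIntegral.integral_mono_on_of_le_Ioo h0.le intervalIntegrable_const (hi h h0 hδ')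
      fun σ hσ => ?_
    exact le_of_lt (hsub ⟨hσ.1, hσ.2.trans hr'⟩)
  have := hle h h0 hδ'
  rw [intervalIntegral.integral_const, sub_zero, smul_eq_mul] at hge
  have : 0 < h * (w / 2) := by positivity
  linarith

section Energy

variable {Ω : Set E3} {T κ C : ℝ} {u : ℝ → E3 → ℝ} {Du : ℝ → E3 → E3} {f : ℝ → E3 → ℝ}
  {Φ G G' : ℝ → ℝ}

/-- `u` satisfies the balance law `∂ₜ u - κ Δ u + f = 0`, in the sense of distributions on `(0,T)`,
when tested with `ψ`. -/
def SatisfiesBalance (Ω : Set E3) (T κ : ℝ) (u : ℝ → E3 → ℝ) (Du : ℝ → E3 → E3)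
    (f : ℝ → E3 → ℝ) (ψ : E3 → ℝ) (Dψ : E3 → E3) : Prop :=
  ∀ ζ, IsTimeTest T ζ → -(∫ s in Ioo 0 T, deriv ζ s * ∫ x in Ω, u s x * ψ x)
    + ∫ s in Ioo 0 T, ζ s * (κ * (∫ x in Ω, inner ℝ (Du s x) (Dψ x)) + ∫ x in Ω, f s x * ψ x) = 0

/-- Against a fixed `ψ`, the pairing with `u` is continuous in time and has an integrable
distributional derivative, so it is a primitive. The bound on `ψ` makes the term with the merely
integrable `f` meaningful. -/
theorem SatisfiesBalance.sub_eq (hfin : volume Ω ≠ ⊤) (hT : 0 < T)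
    (hDu : MemLp (fun p : ℝ × E3 => Du p.1 p.2) 2 (cylinder Ω T)) (hc : WeaklyContinuousL2 Ω T u)
    (hf : Integrable (fun p : ℝ × E3 => f p.1 p.2) (cylinder Ω T)) {ψ : E3 → ℝ} {Dψ : E3 → E3}
    (hψ : MemLp ψ 2 (volume.restrict Ω)) (hψ1 : ∀ x, |ψ x| ≤ 1)
    (hDψ : MemLp Dψ 2 (volume.restrict Ω)) (h : SatisfiesBalance Ω T κ u Du f ψ Dψ)
    {a b : ℝ} (ha : a ∈ Icc 0 T) (hb : b ∈ Icc 0 T) :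
    (∫ x in Ω, u b x * ψ x) - ∫ x in Ω, u a x * ψ x
      = -∫ s in a..b, (κ * (∫ x in Ω, inner ℝ (Du s x) (Dψ x)) + ∫ x in Ω, f s x * ψ x) := by
  have : IsFiniteMeasure (volume.restrict Ω) := ⟨by simpa using hfin.lt_top⟩
  refine sub_eq_neg_integral_of_timeTest hT (hc.2 ψ hψ) ?_ h ha hb
  have h1 : Integrable (fun p : ℝ × E3 => inner ℝ (Du p.1 p.2) (Dψ p.2)) (cylinder Ω T) :=
    integrable_inner_of_memLp hDu (hDψ.comp_snd _)
  have h2 : Integrable (fun p : ℝ × E3 => f p.1 p.2 * ψ p.2) (cylinder Ω T) :=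
    hf.mul_bdd (c := 1) hψ.aestronglyMeasurable.comp_snd (.of_forall fun p => hψ1 _)
  exact (h1.integral_prod_left.const_mul κ).add h2.integral_prod_left

/-- Convexity, integrated over `Ω`. It serves twice: for backward increments in time, and with `v`
the state at the final time as weak lower semicontinuity. -/
theorem energy_sub_le (hfin : volume Ω ≠ ⊤) (htr : IsTruncation Φ G G' C) {v w : E3 → ℝ}
    (hv : MemLp v 2 (volume.restrict Ω)) (hw : MemLp w 2 (volume.restrict Ω)) :
    (∫ x in Ω, Φ (v x)) - ∫ x in Ω, Φ (w x)
      ≤ (∫ x in Ω, v x * G (v x)) - ∫ x in Ω, w x * G (v x) := by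
  have : IsFiniteMeasure (volume.restrict Ω) := ⟨by simpa using hfin.lt_top⟩
  have hΦ : ∀ z : E3 → ℝ, MemLp z 2 (volume.restrict Ω) →
      Integrable (fun x => Φ (z x)) (volume.restrict Ω) := fun z hz =>
    (memLp_comp_of_hasDerivAt hz htr.hasDerivAt htr.abs_le_one).integrable (by norm_num)
  have hG : MemLp (fun x => G (v x)) 2 (volume.restrict Ω) :=
    memLp_comp_of_hasDerivAt hv htr.hasDerivAt' htr.abs_le
  have hi : ∀ z : E3 → ℝ, MemLp z 2 (volume.restrict Ω) →
      Integrable (fun x => z x * G (v x)) (volume.restrict Ω) := fun z hz =>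
    hz.integrable_mul hG
  rw [← integral_sub (hΦ v hv) (hΦ w hw), ← integral_sub (hi v hv) (hi w hw)]
  refine integral_mono ((hΦ v hv).sub (hΦ w hw)) ((hi v hv).sub (hi w hw)) fun x => ?_
  have := htr.sub_le (v x) (w x)
  simp only
  linarith

/-- Time integral of the backward increments of a function frozen at `0` for negative times. -/
theorem integral_sub_backward {E : ℝ → ℝ} {t₀ h : ℝ} (hE : IntervalIntegrable E volume 0 t₀)
    (h0 : 0 < h) (ht : h < t₀) :
    IntervalIntegrable (fun t => E (max (t - h) 0)) volume 0 t₀ ∧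
    (∫ t in (0 : ℝ)..t₀, (E t - E (max (t - h) 0))) = (∫ t in (t₀ - h)..t₀, E t) - h * E 0 := by
  have hE1 : IntervalIntegrable E volume 0 (t₀ - h) := hE.mono_set (by
    rw [uIcc_of_le (by linarith), uIcc_of_le (by linarith)]; exact Icc_subset_Icc_right (by linarith))
  have hE2 : IntervalIntegrable E volume (t₀ - h) t₀ := hE.mono_set (by
    rw [uIcc_of_le (by linarith), uIcc_of_le (by linarith)]; exact Icc_subset_Icc_left (by linarith))
  have c1 : ∀ t ∈ uIcc 0 h, E (max (t - h) 0) = E 0 := fun t ht' => by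
    rw [uIcc_of_le h0.le] at ht'
    rw [max_eq_right (by linarith [ht'.2])]
  have c2 : ∀ t ∈ uIcc h t₀, E (max (t - h) 0) = E (t - h) := fun t ht' => by
    rw [uIcc_of_le ht.le] at ht'
    rw [max_eq_left (by linarith [ht'.1])]
  have i1 : IntervalIntegrable (fun t => E (max (t - h) 0)) volume 0 h :=
    (intervalIntegrable_const (c := E 0)).congr fun t ht' => (c1 t (uIoc_subset_uIcc ht')).symm
  have i2' : IntervalIntegrable (fun t => E (t - h)) volume h t₀ := by
    simpa using hE1.comp_sub_right h
  have i2 : IntervalIntegrable (fun t => E (max (t - h) 0)) volume h t₀ :=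
    i2'.congr fun t ht' => (c2 t (uIoc_subset_uIcc ht')).symm
  refine ⟨i1.trans i2, ?_⟩
  rw [intervalIntegral.integral_sub hE (i1.trans i2),
    ← intervalIntegral.integral_add_adjacent_intervals i1 i2, intervalIntegral.integral_congr c1,
    intervalIntegral.integral_congr c2, intervalIntegral.integral_comp_sub_right (fun t => E t) h,
    ← intervalIntegral.integral_add_adjacent_intervals hE1 hE2]
  simp only [intervalIntegral.integral_const, sub_zero, sub_self, smul_eq_mul]
  ring

end Energy

section EnergyInequality

variable {Ω : Set E3} {T κ C : ℝ} {u : ℝ → E3 → ℝ} {Du : ℝ → E3 → E3} {f : ℝ → E3 → ℝ}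
  {Φ G G' : ℝ → ℝ}

/-- Energy inequality: a weakly continuous solution of a balance law may be tested with a bounded
truncation of itself. -/
theorem energy_inequality (hΩ : MeasurableSet Ω) (hfin : volume Ω ≠ ⊤) (hT : 0 < T)
    (hu : MemL2H1 Ω T u Du) (hc : WeaklyContinuousL2 Ω T u)
    (hf : Integrable (fun p : ℝ × E3 => f p.1 p.2) (cylinder Ω T))
    (htr : IsTruncation Φ G G' C)
    (heq : ∀ᵐ t ∂volume.restrict (Ioo 0 T), SatisfiesBalance Ω T κ u Du f
      (fun x => G (u t x)) (fun x => G' (u t x) • Du t x))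
    {t₀ : ℝ} (ht₀ : t₀ ∈ Ioc 0 T) :
    (∫ x in Ω, Φ (u t₀ x)) + ∫ p, (κ * (G' (u p.1 p.2) * ‖Du p.1 p.2‖ ^ 2)
      + f p.1 p.2 * G (u p.1 p.2)) ∂cylinder Ω t₀ ≤ ∫ x in Ω, Φ (u 0 x) := by
  have hμ : IsFiniteMeasure (volume.restrict Ω) := ⟨by simpa using hfin.lt_top⟩
  have hcyl : IsFiniteMeasure (cylinder Ω T) := by unfold cylinder; infer_instance
  have hGc := htr.continuous_deriv
  have ht₀T : t₀ ∈ Icc 0 T := ⟨ht₀.1.le, ht₀.2⟩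
  -- Two times occur: the flux is taken at `s`, the test function is frozen at `t`, since the
  -- spatial test functions of the balance law do not depend on time.
  set q : ℝ → ℝ → ℝ := fun t s => κ * (∫ x in Ω, inner ℝ (Du s x) (G' (u t x) • Du t x))
    + ∫ x in Ω, f s x * G (u t x) with hq
  set E : ℝ → ℝ := fun t => ∫ x in Ω, Φ (u t x) with hE
  -- the identity in integrated form
  have hB2 : ∀ᵐ t ∂volume.restrict (Ioo 0 T),
      MemLp (fun x => G' (u t x) • Du t x) 2 (volume.restrict Ω) := by
    filter_upwards [hu.isH1] with t ht
    exact memLp_smul_of_bounded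
      (htr.continuous.comp_aestronglyMeasurable ht.memLp.aestronglyMeasurable)
      (fun x => htr.abs_le _) ht.memLp_grad
  have hId : ∀ᵐ t ∂volume.restrict (Ioo 0 T), ∀ a ∈ Icc 0 T, ∀ b ∈ Icc 0 T,
      (∫ x in Ω, u b x * G (u t x)) - ∫ x in Ω, u a x * G (u t x) = -∫ s in a..b, q t s := by
    filter_upwards [heq, hu.isH1, hB2] with t ht htH htB a ha b hb
    exact ht.sub_eq hfin hT hu.memLp_grad hc hf
      (memLp_comp_of_hasDerivAt htH.memLp htr.hasDerivAt' htr.abs_le)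
      (fun x => htr.abs_le_one _) htB ha hb
  -- extension by zero
  set S : Set (ℝ × E3) := Ioo 0 t₀ ×ˢ Ω with hS
  have hSm : MeasurableSet S := measurableSet_Ioo.prod hΩ
  have hle : volume.restrict S ≤ cylinder Ω T := by
    rw [hS, ← cylinder_eq_restrict]; exact cylinder_mono Ω ht₀.2
  set A : ℝ × E3 → E3 := S.indicator fun p => Du p.1 p.2 with hA
  set B : ℝ × E3 → E3 := S.indicator fun p => G' (u p.1 p.2) • Du p.1 p.2 with hB
  set F : ℝ × E3 → ℝ := S.indicator fun p => f p.1 p.2 with hF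
  set g : ℝ × E3 → ℝ := S.indicator fun p => G (u p.1 p.2) with hg
  have hA2 : MemLp A 2 := (memLp_indicator_iff_restrict hSm).2 (hu.memLp_grad.mono_measure hle)
  have hB2' : MemLp B 2 := (memLp_indicator_iff_restrict hSm).2
    ((memLp_smul_of_bounded (htr.continuous.comp_aestronglyMeasurable hu.memLp.aestronglyMeasurable)
      (fun x => htr.abs_le _) hu.memLp_grad).mono_measure hle)
  have hF1 : Integrable F := (integrable_indicator_iff hSm).2 (hf.mono_measure hle)
  have hgm : AEStronglyMeasurable g := (aestronglyMeasurable_indicator_iff hSm).2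
    ((hGc.comp_aestronglyMeasurable hu.memLp.aestronglyMeasurable).mono_measure hle)
  have hg1 : ∀ p, |g p| ≤ 1 := fun p => by
    by_cases hp : p ∈ S
    · rw [hg, indicator_of_mem hp]; exact htr.abs_le_one _
    · rw [hg, indicator_of_notMem hp]; simp
  set J := shiftPairing κ A B F g with hJ
  -- the pairing at fixed time
  have hk : ∀ᵐ t ∂volume.restrict (Ioo 0 t₀), ∀ h, 0 < h →
      ∫ σ in (0 : ℝ)..h, ∫ x, J σ (t, x) = ∫ s in (max (t - h) 0)..t, q t s := by
    have hsub : Ioo 0 t₀ ⊆ Ioo 0 T := Ioo_subset_Ioo_right ht₀.2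
    have hfs := hf.prod_right_ae
    filter_upwards [ae_restrict_of_ae_restrict_of_subset hsub hB2,
      ae_restrict_of_ae_restrict_of_subset hsub hu.isH1, ae_restrict_mem measurableSet_Ioo]
      with t htB htH ht h hh
    set k : ℝ → ℝ := fun s => ∫ x, (κ * inner ℝ (A (s, x)) (B (t, x)) + F (s, x) * g (t, x)) with hkdef
    have e1 : ∫ σ in (0 : ℝ)..h, ∫ x, J σ (t, x) = ∫ s in (t - h)..t, k s := by
      have := intervalIntegral.integral_comp_sub_left (a := 0) (b := h) k t
      rw [sub_zero] at this
      exact this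
    have hm1 : max (t - h) 0 ≤ t := max_le (by linarith) ht.1.le
    rw [e1, intervalIntegral.integral_of_le (by linarith), intervalIntegral.integral_of_le hm1]
    -- The extended fluxes vanish at negative times, which matches freezing the energy at its value
    -- at `0`.
    have e2 : ∫ s in Ioc (t - h) t, k s = ∫ s in Ioc (max (t - h) 0) t, k s := by
      refine setIntegral_eq_of_subset_of_forall_sdiff_eq_zero measurableSet_Ioc
        (Ioc_subset_Ioc_left (le_max_left _ _)) fun s hs => ?_
      have hs0 : s ≤ 0 := by
        by_contra! hs0
        exact hs.2 ⟨max_lt hs.1.1 hs0, hs.1.2⟩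
      have hns : ∀ x, (s, x) ∉ S := fun x hx => absurd hx.1.1 (not_lt.2 hs0)
      simp [hkdef, hA, hF, hns]
    rw [e2]
    refine setIntegral_congr_ae measurableSet_Ioc ?_
    rw [ae_restrict_iff' measurableSet_Ioo] at hfs
    have hH := hu.isH1
    rw [ae_restrict_iff' measurableSet_Ioo] at hH
    filter_upwards [hfs, hH] with s hs1 hs2 hs
    have hst : s ∈ Ioo 0 t₀ := ⟨(le_max_right _ _).trans_lt hs.1, hs.2.trans_lt ht.2⟩
    have hi1 : Integrable (fun x => inner ℝ (Du s x) (G' (u t x) • Du t x)) (volume.restrict Ω) :=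
      integrable_inner_of_memLp (hs2 (hsub hst)).memLp_grad htB
    have hi2 : Integrable (fun x => f s x * G (u t x)) (volume.restrict Ω) :=
      (hs1 (hsub hst)).mul_bdd (c := 1) (hGc.comp_aestronglyMeasurable htH.memLp.aestronglyMeasurable)
        (.of_forall fun x => htr.abs_le_one _)
    rw [hq]
    simp only
    rw [← integral_const_mul, ← integral_add (hi1.const_mul κ) hi2, ← integral_indicator hΩ, hkdef]
    refine integral_congr_ae (.of_forall fun x => ?_)
    by_cases hx : x ∈ Ω
    · have m1 : (s, x) ∈ S := ⟨hst, hx⟩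
      have m2 : (t, x) ∈ S := ⟨ht, hx⟩
      simp [hA, hB, hF, hg, m1, m2, hx]
    · have m1 : (s, x) ∉ S := fun h => hx h.2
      simp [hA, hF, m1, hx]
  have hEi : IntegrableOn E (Ioo 0 T) :=
    ((memLp_comp_of_hasDerivAt hu.memLp htr.hasDerivAt htr.abs_le_one).integrable
      (by norm_num)).integral_prod_left
  have hEI : IntervalIntegrable E volume 0 t₀ :=
    (intervalIntegrable_iff_integrableOn_Ioo_of_le ht₀.1.le).2
      (hEi.mono_set (Ioo_subset_Ioo_right ht₀.2))
  -- integration in time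
  have hRint : ∀ h, 0 < h → IntervalIntegrable (fun σ => ∫ p, J σ p) volume 0 h := fun h hh => by
    rw [intervalIntegrable_iff_integrableOn_Ioc_of_le hh.le]
    exact (integrable_shiftPairing κ hA2 hB2' hF1 hgm hg1 _).integral_prod_left
  -- Convexity turns the identity between `max (t - h) 0` and `t` into a bound on the energy
  -- increment. Integration over `t` telescopes the left side; Fubini regroups the right side by the
  -- shift `σ`.
  have hmain : ∀ h, 0 < h → h < t₀ →
      (∫ t in (t₀ - h)..t₀, E t) - h * E 0 ≤ -∫ σ in (0 : ℝ)..h, ∫ p, J σ p := by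
    intro h hh hht
    have hJi := integrable_shiftPairing κ hA2 hB2' hF1 hgm hg1 (volume.restrict (Ioc 0 h))
    have hJassoc : Integrable (fun p : (ℝ × ℝ) × E3 => J p.1.1 (p.1.2, p.2))
        (((volume.restrict (Ioc 0 h)).prod volume).prod volume) := by
      have := (measurePreserving_prodAssoc (volume.restrict (Ioc 0 h)) (volume : Measure ℝ)
        (volume : Measure E3)).integrable_comp_of_integrable hJi
      exact this
    have hK : Integrable (fun p : ℝ × ℝ => ∫ x, J p.1 (p.2, x))
        ((volume.restrict (Ioc 0 h)).prod volume) := hJassoc.integral_prod_left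
    have hfub : ∫ σ in (0 : ℝ)..h, ∫ p, J σ p
        = ∫ t in (0 : ℝ)..t₀, ∫ σ in (0 : ℝ)..h, ∫ x, J σ (t, x) := by
      rw [intervalIntegral.integral_of_le hh.le, intervalIntegral.integral_of_le ht₀.1.le]
      simp only [intervalIntegral.integral_of_le hh.le]
      have s1 : ∫ σ in Ioc 0 h, ∫ p, J σ p = ∫ σ in Ioc 0 h, ∫ t, ∫ x, J σ (t, x) := by
        refine integral_congr_ae ?_
        filter_upwards [hJi.prod_right_ae] with σ hσ
        rw [Measure.volume_eq_prod] at hσ ⊢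
        exact integral_prod _ hσ
      rw [s1, integral_integral_swap hK]
      refine (setIntegral_eq_integral_of_forall_compl_eq_zero (s := Ioc 0 t₀) fun t ht => ?_).symm
      have hns : ∀ x, (t, x) ∉ S := fun x hx => ht ⟨hx.1.1, hx.1.2.le⟩
      simp [hJ, shiftPairing, hB, hg, hns]
    obtain ⟨hEs, hEsub⟩ := integral_sub_backward hEI hh hht
    rw [← hEsub, hfub, ← intervalIntegral.integral_neg]
    have hKt : IntervalIntegrable (fun t => ∫ σ in (0 : ℝ)..h, ∫ x, J σ (t, x)) volume 0 t₀ := by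
      simp only [intervalIntegral.integral_of_le hh.le]
      exact hK.integral_prod_right.intervalIntegrable
    refine intervalIntegral.integral_mono_ae_restrict ht₀.1.le (hEI.sub hEs) hKt.neg ?_
    rw [← restrict_Ioo_eq_restrict_Icc]
    filter_upwards [hk, ae_restrict_of_ae_restrict_of_subset (Ioo_subset_Ioo_right ht₀.2) hId,
      ae_restrict_mem measurableSet_Ioo] with t hkt hIdt ht
    have htT : t ∈ Icc 0 T := ⟨ht.1.le, (ht.2.le.trans ht₀.2)⟩
    have hsT : max (t - h) 0 ∈ Icc 0 T := ⟨le_max_right _ _, max_le (by linarith [htT.2]) hT.le⟩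
    rw [hkt h hh, ← hIdt _ hsT _ htT]
    exact energy_sub_le hfin htr (hc.1 t htT) (hc.1 _ hsT)
  -- lower semicontinuity at the final time
  set m : ℝ → ℝ := fun t => (∫ x in Ω, u t x * G (u t₀ x)) - ∫ x in Ω, u t₀ x * G (u t₀ x) with hm
  have hGt₀ : MemLp (fun x => G (u t₀ x)) 2 (volume.restrict Ω) :=
    memLp_comp_of_hasDerivAt (hc.1 t₀ ht₀T) htr.hasDerivAt' htr.abs_le
  have hmc : ContinuousOn m (Icc 0 T) := (hc.2 _ hGt₀).sub continuousOn_const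
  have hlsc : ∀ t ∈ Icc 0 T, E t₀ + m t ≤ E t := fun t ht => by
    have := energy_sub_le hfin htr (hc.1 t₀ ht₀T) (hc.1 t ht)
    simp only [hE, hm]
    linarith
  -- Its integral over `(0, h)` is nonpositive by `hmain` and `hlsc`, and its limit at `0` is the
  -- difference of the two sides of the claim, as `m` vanishes at `t₀`.
  set W : ℝ → ℝ := fun σ => (E t₀ - E 0) + m (t₀ - σ) + ∫ p, J σ p with hW
  have hmσ : ContinuousOn (fun σ => m (t₀ - σ)) (Icc 0 t₀) := by
    refine hmc.comp (by fun_prop) fun σ hσ => ⟨by linarith [hσ.2], by linarith [hσ.1, ht₀.2]⟩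
  have hmσi : ∀ h, 0 < h → h < t₀ → IntervalIntegrable (fun σ => m (t₀ - σ)) volume 0 h :=
    fun h hh hht => (hmσ.mono (by
      rw [uIcc_of_le hh.le]; exact Icc_subset_Icc_right hht.le)).intervalIntegrable
  have hWi : ∀ h, 0 < h → h < t₀ → IntervalIntegrable W volume 0 h := fun h hh hht =>
    (intervalIntegrable_const.add (hmσi h hh hht)).add (hRint h hh)
  have hWlim : Tendsto W (𝓝[>] 0) (𝓝 ((E t₀ - E 0) + m t₀ + ∫ p, J 0 p)) := by
    refine (tendsto_const_nhds.add ?_).add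
      ((tendsto_integral_shiftPairing κ hA2 hB2' hF1 hgm hg1).mono_left nhdsWithin_le_nhds)
    have := hmσ 0 ⟨le_rfl, ht₀.1.le⟩
    rw [ContinuousWithinAt, sub_zero] at this
    refine this.mono_left ?_
    rw [← nhdsWithin_Ioo_eq_nhdsGT ht₀.1]
    exact nhdsWithin_mono _ Ioo_subset_Icc_self
  have hfinal := le_zero_of_integral_le_zero ht₀.1 hWlim hWi fun h hh hht => by
    have h1 : ∫ σ in (0 : ℝ)..h, W σ
        = h * (E t₀ - E 0) + (∫ t in (t₀ - h)..t₀, m t) + ∫ σ in (0 : ℝ)..h, ∫ p, J σ p := by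
      rw [hW, intervalIntegral.integral_add (intervalIntegrable_const.add (hmσi h hh hht))
        (hRint h hh), intervalIntegral.integral_add intervalIntegrable_const (hmσi h hh hht),
        intervalIntegral.integral_comp_sub_left (fun t => m t) t₀]
      simp only [intervalIntegral.integral_const, sub_zero, smul_eq_mul]
    have hsubI : Icc (t₀ - h) t₀ ⊆ Icc 0 T := Icc_subset_Icc (by linarith) ht₀.2
    have hmI : IntervalIntegrable m volume (t₀ - h) t₀ := (hmc.mono (by
      rw [uIcc_of_le (by linarith)]; exact hsubI)).intervalIntegrable
    have h2 : ∫ t in (t₀ - h)..t₀, (E t₀ + m t) ≤ ∫ t in (t₀ - h)..t₀, E t := by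
      refine intervalIntegral.integral_mono_on (by linarith)
        (intervalIntegrable_const.add hmI) (hEI.mono_set ?_) fun t ht => hlsc t (hsubI ht)
      rw [uIcc_of_le (by linarith), uIcc_of_le ht₀.1.le]
      exact Icc_subset_Icc_left (by linarith)
    rw [intervalIntegral.integral_add intervalIntegrable_const hmI,
      intervalIntegral.integral_const, smul_eq_mul, sub_sub_cancel] at h2
    have h3 := hmain h hh hht
    rw [h1]
    linarith
  have hm0 : m t₀ = 0 := by simp [hm]
  have hJ0 : ∫ p, J 0 p = ∫ p, (κ * (G' (u p.1 p.2) * ‖Du p.1 p.2‖ ^ 2)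
      + f p.1 p.2 * G (u p.1 p.2)) ∂cylinder Ω t₀ := by
    rw [cylinder_eq_restrict, ← integral_indicator hSm]
    refine integral_congr_ae (.of_forall fun p => ?_)
    by_cases hp : p ∈ S
    · simp [hJ, shiftPairing, hA, hB, hF, hg, hp, real_inner_smul_right]
    · simp [hJ, shiftPairing, hB, hg, hp]
  rw [hm0, hJ0] at hfinal
  simp only [hE] at hfinal
  linarith

end EnergyInequality

/-! ### The boundary has finite surface measure -/

/-- A positive value would persist on a neighbourhood, which must meet `Ω`; a negative one would put
the point inside the open set `Ω`. -/
theorem IsLocalDefiningFunction.eq_zero_of_mem_frontier {Ω U : Set E3} {x₀ : E3} {f : E3 → ℝ}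
    (hΩ : IsOpen Ω) (h : IsLocalDefiningFunction Ω x₀ U f) {x : E3} (hx : x ∈ frontier Ω)
    (hxU : x ∈ U) : f x = 0 := by
  have hxΩ : x ∉ Ω := by
    rw [hΩ.frontier_eq] at hx; exact hx.2
  refine le_antisymm ?_ ?_
  · by_contra! hpos
    have hcont : ContinuousAt f x :=
      (h.contDiffOn.continuousOn).continuousAt (h.isOpen.mem_nhds hxU)
    have hnhds : {y | 0 < f y} ∩ U ∈ 𝓝 x :=
      inter_mem (hcont.eventually (lt_mem_nhds hpos)) (h.isOpen.mem_nhds hxU)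
    obtain ⟨y, hy, hyΩ⟩ := mem_closure_iff_nhds.1 (frontier_subset_closure hx) _ hnhds
    have : y ∈ U ∩ Ω := ⟨hy.2, hyΩ⟩
    rw [h.inter_eq] at this
    exact absurd this.2 (not_lt.2 (le_of_lt hy.1))
  · by_contra! hneg
    have : x ∈ U ∩ Ω := by rw [h.inter_eq]; exact ⟨hxU, hneg⟩
    exact hxΩ this.2

/-- Forgetting the `i`-th coordinate. -/
def dropCoord (i : Fin 3) (x : E3) : Fin 2 → ℝ := fun j => x (i.succAbove j)

theorem lipschitzWith_dropCoord (i : Fin 3) : LipschitzWith 1 (dropCoord i) := by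
  refine LipschitzWith.of_dist_le_mul fun x y => ?_
  rw [NNReal.coe_one, one_mul, dist_pi_le_iff dist_nonneg]
  intro j
  rw [dist_eq_norm x y, Real.dist_eq]
  exact PiLp.norm_apply_le (x - y) (i.succAbove j)

/-- Compares the Euclidean norm of two coordinates with their sup norm; `√2` would do, `2` avoids
the root. -/
theorem norm_sub_single_le (i : Fin 3) (d : E3) :
    ‖d - EuclideanSpace.single i (d i)‖ ≤ 2 * ‖dropCoord i d‖ := by
  have hj : ∀ j, |d (i.succAbove j)| ≤ ‖dropCoord i d‖ := fun j => norm_le_pi_norm (dropCoord i d) j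
  rw [EuclideanSpace.norm_eq]
  refine Real.sqrt_le_iff.2 ⟨by positivity, ?_⟩
  rw [Fin.sum_univ_succAbove _ i]
  have h0 := sq_le_sq' (abs_le.1 (hj 0)).1 (abs_le.1 (hj 0)).2
  have h1 := sq_le_sq' (abs_le.1 (hj 1)).1 (abs_le.1 (hj 1)).2
  simp only [PiLp.sub_apply, PiLp.single_apply, if_true, sub_self, norm_zero,
    Fin.succAbove_ne, if_false, sub_zero, Fin.sum_univ_two, Real.norm_eq_abs, sq_abs]
  nlinarith [sq_nonneg ‖dropCoord i d‖]

/-- The zero set of a function with nonvanishing strict derivative has locally finite surface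
measure. -/
theorem exists_surf_zeroSet_lt_top {f : E3 → ℝ} {f' : E3 →L[ℝ] ℝ} {x₀ : E3}
    (hf : HasStrictFDerivAt f f' x₀) (hf' : f' ≠ 0) :
    ∃ V ∈ 𝓝 x₀, surf (V ∩ {x | f x = 0}) < ⊤ := by
  obtain ⟨i, hi⟩ : ∃ i, f' (EuclideanSpace.single i 1) ≠ 0 := by
    by_contra! h
    refine hf' (ContinuousLinearMap.coe_injective
      ((EuclideanSpace.basisFun (Fin 3) ℝ).toBasis.ext fun i => ?_))
    simpa using h i
  set a := |f' (EuclideanSpace.single i 1)| with ha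
  have ha0 : 0 < a := abs_pos.2 hi
  have hlo := hf.isLittleO.def (half_pos ha0)
  rw [nhds_prod_eq] at hlo
  obtain ⟨V, hV, hVV⟩ := (eventually_prod_self_iff
    (r := fun x y => ‖f x - f y - f' (x - y)‖ ≤ a / 2 * ‖x - y‖)).1 hlo
  set s : Set E3 := (V ∩ Metric.ball x₀ 1) ∩ {x | f x = 0} with hs
  -- The tolerance `a / 2` lets half of `a * |d i|` be absorbed, leaving `|d i| ≤ (4 * ‖f'‖ / a + 2)
  -- * N`; the remaining coordinates contribute another `2 * N`.
  set K : ℝ := 4 * ‖f'‖ / a + 4 with hK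
  have hK0 : 0 ≤ K := by positivity
  have hdrop : ∀ x y, dropCoord i (x - y) = dropCoord i x - dropCoord i y := fun x y => by
    ext j; simp [dropCoord]
  -- On the zero set strict differentiability makes `f' (x - y)` small, so the coordinate along
  -- which `f'` is nonzero is controlled by the other two. The zero set is locally a Lipschitz graph
  -- over a plane.
  have hanti : ∀ x ∈ s, ∀ y ∈ s, dist x y ≤ K * dist (dropCoord i x) (dropCoord i y) := by
    intro x hx y hy
    have h1 := hVV x hx.1.1 y hy.1.1
    simp only [show f x = 0 from hx.2, show f y = 0 from hy.2, sub_self, zero_sub, norm_neg] at h1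
    rw [dist_eq_norm, dist_eq_norm, ← hdrop]
    set d := x - y
    set N := ‖dropCoord i d‖ with hN
    have hN0 : 0 ≤ N := norm_nonneg _
    have h2 := norm_sub_single_le i d
    set e := d - EuclideanSpace.single i (d i) with he
    have hde : d = e + (d i) • EuclideanSpace.single i (1 : ℝ) := by
      rw [he]
      ext j
      by_cases hj : j = i <;> simp [hj]
    have hnd : ‖d‖ ≤ 2 * N + |d i| := by
      calc ‖d‖ = ‖e + (d i) • EuclideanSpace.single i (1 : ℝ)‖ := by rw [← hde]
        _ ≤ ‖e‖ + ‖(d i) • EuclideanSpace.single i (1 : ℝ)‖ := norm_add_le _ _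
        _ ≤ 2 * N + |d i| := by
          rw [norm_smul]
          simp only [PiLp.norm_single, norm_one, mul_one, Real.norm_eq_abs]
          linarith
    have hfd : a * |d i| ≤ ‖f' d‖ + ‖f'‖ * (2 * N) := by
      have e1 : d i * f' (EuclideanSpace.single i 1) = f' d - f' e := by
        conv_rhs => rw [hde]
        simp
      calc a * |d i| = ‖f' d - f' e‖ := by rw [← e1, Real.norm_eq_abs, abs_mul, mul_comm]
        _ ≤ ‖f' d‖ + ‖f' e‖ := norm_sub_le _ _
        _ ≤ _ := by
          gcongr
          exact (f'.le_opNorm e).trans (mul_le_mul_of_nonneg_left h2 (norm_nonneg _))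
    have hdi : |d i| ≤ (4 * ‖f'‖ / a + 2) * N := by
      have : (4 * ‖f'‖ / a + 2) * N = (2 * ‖f'‖ * N + a * N) / (a / 2) := by
        field_simp
        ring
      rw [this, le_div_iff₀ (half_pos ha0)]
      nlinarith
    calc ‖d‖ ≤ 2 * N + |d i| := hnd
      _ ≤ 2 * N + (4 * ‖f'‖ / a + 2) * N := by gcongr
      _ = K * N := by rw [hK]; ring
  refine ⟨V ∩ Metric.ball x₀ 1, inter_mem hV (Metric.ball_mem_nhds _ one_pos), ?_⟩
  have hal : AntilipschitzWith ⟨K, hK0⟩ (fun x : s => dropCoord i x) :=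
    AntilipschitzWith.of_le_mul_dist fun x y => hanti x x.2 y y.2
  -- With the sup norm on the plane, two-dimensional Hausdorff measure is Lebesgue measure, which is
  -- finite on the bounded projection.
  have hcard : (Measure.hausdorffMeasure 2 : Measure (Fin 2 → ℝ)) = volume := by
    have := hausdorffMeasure_pi_real (ι := Fin 2)
    simpa using this
  have hbd : Bornology.IsBounded ((fun x : s => dropCoord i x) '' univ) := by
    have : Bornology.IsBounded (dropCoord i '' s) := (lipschitzWith_dropCoord i).isBounded_image
      (Metric.isBounded_ball.subset (fun x hx => hx.1.2))
    refine this.subset ?_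
    rintro _ ⟨x, -, rfl⟩
    exact ⟨x, x.2, rfl⟩
  have h1 := hal.le_hausdorffMeasure_image (d := 2) (by norm_num) univ
  rw [hcard] at h1
  have h2 := (isometry_subtype_coe (s := s)).hausdorffMeasure_image (d := 2)
    (Or.inl (by norm_num)) univ
  rw [image_univ, Subtype.range_coe] at h2
  rw [surf, h2]
  exact h1.trans_lt (ENNReal.mul_lt_top
    (ENNReal.rpow_lt_top_of_nonneg (by norm_num) ENNReal.coe_ne_top) hbd.measure_lt_top)

/-- Compactness of the boundary reduces this to the local bound for zero sets. Finiteness puts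
constants in `L²(∂Ω)`, so Lipschitz functions of a trace are again square integrable. -/
theorem surf_frontier_lt_top {Ω : Set E3} (hΩ : IsOpen Ω) (hb : Bornology.IsBounded Ω)
    (h : HasC2Boundary Ω) : surf (frontier Ω) < ⊤ := by
  have hcomp : IsCompact (frontier Ω) :=
    Metric.isCompact_of_isClosed_isBounded isClosed_frontier (hb.closure.subset
      frontier_subset_closure)
  refine hcomp.measure_lt_top_of_nhdsWithin fun x₀ hx₀ => ?_
  obtain ⟨U, f, hf⟩ := h x₀ hx₀
  have hcd : ContDiffAt ℝ 2 f x₀ := hf.contDiffOn.contDiffAt (hf.isOpen.mem_nhds hf.mem)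
  have hne : fderiv ℝ f x₀ ≠ 0 := fun h0 => hf.gradient_ne_zero (by simp [gradient, h0])
  obtain ⟨V, hV, hVlt⟩ := exists_surf_zeroSet_lt_top (hcd.hasStrictFDerivAt (by norm_num)) hne
  refine ⟨_, inter_mem (mem_nhdsWithin_of_mem_nhds (inter_mem hV (hf.isOpen.mem_nhds hf.mem)))
    self_mem_nhdsWithin, (measure_mono ?_).trans_lt hVlt⟩
  exact fun x hx => ⟨hx.1.1, hf.eq_zero_of_mem_frontier hΩ hx.2 hx.1.2⟩

/-! ### Calculus of traces -/

section Trace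

variable {Ω : Set E3} {u₁ u₂ u τ τ₁ τ₂ : E3 → ℝ} {Du₁ Du₂ Du : E3 → E3}

theorem HasWeakFDeriv.add (hu₁ : IntegrableOn u₁ Ω) (hu₂ : IntegrableOn u₂ Ω)
    (hDu₁ : IntegrableOn Du₁ Ω) (hDu₂ : IntegrableOn Du₂ Ω)
    (h₁ : HasWeakFDeriv Ω u₁ (fun x => innerSL ℝ (Du₁ x)))
    (h₂ : HasWeakFDeriv Ω u₂ (fun x => innerSL ℝ (Du₂ x))) :
    HasWeakFDeriv Ω (fun x => u₁ x + u₂ x) (fun x => innerSL ℝ (Du₁ x + Du₂ x)) := by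
  intro φ hφ hφs hφΩ y
  have hdφc : Continuous (fun x => fderiv ℝ φ x y) := by
    have := hφ.continuous_fderiv (by simp)
    fun_prop
  have hdφs : HasCompactSupport (fun x => fderiv ℝ φ x y) :=
    (hφs.fderiv ℝ).comp_left (g := fun L : E3 →L[ℝ] ℝ => L y) rfl
  obtain ⟨B, hB⟩ := hφs.exists_bound_of_continuous hφ.continuous
  obtain ⟨B', hB'⟩ := hdφs.exists_bound_of_continuous hdφc
  have hi : ∀ w : E3 → ℝ, IntegrableOn w Ω → IntegrableOn (fun x => w x * fderiv ℝ φ x y) Ω :=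
    fun w hw => hw.mul_bdd (c := B') hdφc.aestronglyMeasurable (.of_forall hB')
  have hi' : ∀ w : E3 → E3, IntegrableOn w Ω → IntegrableOn (fun x => φ x * inner ℝ (w x) y) Ω :=
    fun w hw => (hw.inner_const y).bdd_mul (c := B) hφ.continuous.aestronglyMeasurable
      (.of_forall hB)
  have e₁ := h₁ φ hφ hφs hφΩ y
  have e₂ := h₂ φ hφ hφs hφΩ y
  simp only [innerSL_apply_apply] at e₁ e₂ ⊢
  simp only [inner_add_left, mul_add, add_mul]
  rw [integral_add (hi _ hu₁) (hi _ hu₂), integral_add (hi' _ hDu₁) (hi' _ hDu₂), e₁, e₂]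
  ring

theorem IsH1.add (hfin : volume Ω ≠ ⊤) (h₁ : IsH1 Ω u₁ Du₁) (h₂ : IsH1 Ω u₂ Du₂) :
    IsH1 Ω (fun x => u₁ x + u₂ x) (fun x => Du₁ x + Du₂ x) where
  memLp := h₁.memLp.add h₂.memLp
  memLp_grad := h₁.memLp_grad.add h₂.memLp_grad
  weak := h₁.weak.add (h₁.integrableOn hfin) (h₂.integrableOn hfin)
    (h₁.integrableOn_grad hfin) (h₂.integrableOn_grad hfin) h₂.weak

theorem tendsto_eLpNorm_add_sub {F : Type*} [NormedAddCommGroup F] {μ : Measure E3}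
    {a b : ℕ → E3 → F} {a₀ b₀ : E3 → F}
    (ha : ∀ n, AEStronglyMeasurable (a n) μ) (hb : ∀ n, AEStronglyMeasurable (b n) μ)
    (ha₀ : AEStronglyMeasurable a₀ μ) (hb₀ : AEStronglyMeasurable b₀ μ)
    (h₁ : Tendsto (fun n => eLpNorm (fun x => a n x - a₀ x) 2 μ) atTop (𝓝 0))
    (h₂ : Tendsto (fun n => eLpNorm (fun x => b n x - b₀ x) 2 μ) atTop (𝓝 0)) :
    Tendsto (fun n => eLpNorm (fun x => (a n x + b n x) - (a₀ x + b₀ x)) 2 μ) atTop (𝓝 0) := by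
  refine tendsto_of_tendsto_of_tendsto_of_le_of_le tendsto_const_nhds
    (by simpa using h₁.add h₂) (fun _ => zero_le) fun n => ?_
  refine (le_of_eq ?_).trans (eLpNorm_add_le ((ha n).sub ha₀) ((hb n).sub hb₀) (by norm_num))
  congr 1
  ext x
  simp only [Pi.add_apply]
  abel

theorem continuous_gradient {φ : E3 → ℝ} (hφ : ContDiff ℝ 1 φ) : Continuous (gradient φ) :=
  (InnerProductSpace.toDual ℝ E3).symm.continuous.comp (hφ.continuous_fderiv (by simp))

/-- Needed to recover the trace of `θ` from those of `θ - θδ` and of the extension `θδ`. -/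
theorem HasTrace.add (hfin : volume Ω ≠ ⊤) (h₁ : HasTrace Ω u₁ Du₁ τ₁)
    (h₂ : HasTrace Ω u₂ Du₂ τ₂) :
    HasTrace Ω (fun x => u₁ x + u₂ x) (fun x => Du₁ x + Du₂ x) (fun x => τ₁ x + τ₂ x) := by
  obtain ⟨hH₁, hτ₁, φ, hφ, a₁, b₁, c₁⟩ := h₁
  obtain ⟨hH₂, hτ₂, ψ, hψ, a₂, b₂, c₂⟩ := h₂
  refine ⟨hH₁.add hfin hH₂, hτ₁.add hτ₂, fun n x => φ n x + ψ n x, fun n => (hφ n).add (hψ n),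
    tendsto_eLpNorm_add_sub (fun n => (hφ n).continuous.aestronglyMeasurable)
      (fun n => (hψ n).continuous.aestronglyMeasurable) hH₁.memLp.aestronglyMeasurable
      hH₂.memLp.aestronglyMeasurable a₁ a₂, ?_,
    tendsto_eLpNorm_add_sub (fun n => (hφ n).continuous.aestronglyMeasurable)
      (fun n => (hψ n).continuous.aestronglyMeasurable) hτ₁.aestronglyMeasurable
      hτ₂.aestronglyMeasurable c₁ c₂⟩
  have hg : ∀ n x, gradient (fun x => φ n x + ψ n x) x = gradient (φ n) x + gradient (ψ n) x := by
    intro n x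
    simp only [gradient]
    rw [fderiv_fun_add ((hφ n).differentiable (by simp) x) ((hψ n).differentiable (by simp) x),
      map_add]
  simp only [hg]
  exact tendsto_eLpNorm_add_sub (fun n => (continuous_gradient (hφ n)).aestronglyMeasurable)
    (fun n => (continuous_gradient (hψ n)).aestronglyMeasurable)
    hH₁.memLp_grad.aestronglyMeasurable hH₂.memLp_grad.aestronglyMeasurable b₁ b₂

/-- Dominated convergence in `L²` for a bounded sequence of multipliers. -/
theorem tendsto_eLpNorm_smul_of_tendsto_ae {μ : Measure E3} {a : ℕ → E3 → ℝ} {D : E3 → E3}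
    {C : ℝ} (ha : ∀ n, AEStronglyMeasurable (a n) μ) (hC : ∀ n x, |a n x| ≤ C)
    (hD : MemLp D 2 μ) (hlim : ∀ᵐ x ∂μ, Tendsto (fun n => a n x) atTop (𝓝 0)) :
    Tendsto (fun n => eLpNorm (fun x => a n x • D x) 2 μ) atTop (𝓝 0) := by
  have hlin : Tendsto (fun n => ∫⁻ x, ‖a n x • D x‖ₑ ^ (2 : ℝ) ∂μ) atTop (𝓝 (∫⁻ _, 0 ∂μ)) := by
    refine tendsto_lintegral_of_dominated_convergence' (fun x => ‖C • D x‖ₑ ^ (2 : ℝ))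
      (fun n => (((ha n).smul hD.aestronglyMeasurable).enorm).pow_const _)
      (fun n => .of_forall fun x => ?_) ?_ ?_
    · refine ENNReal.rpow_le_rpow ?_ (by norm_num)
      rw [enorm_smul, enorm_smul]
      refine mul_le_mul_left ?_ _
      rw [enorm_le_iff_norm_le, Real.norm_eq_abs]
      exact (hC n x).trans (le_abs_self C)
    · have h := (hD.const_smul C).eLpNorm_lt_top
      rw [eLpNorm_lt_top_iff_lintegral_rpow_enorm_lt_top (by norm_num) (by norm_num)] at h
      simpa using h.ne
    · filter_upwards [hlim] with x hx
      have h1 : Tendsto (fun n => ‖a n x • D x‖ₑ) atTop (𝓝 0) := by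
        have := (hx.smul_const (D x)).enorm
        simpa using this
      have := h1.ennrpow_const (2 : ℝ)
      simpa using this
  rw [lintegral_zero] at hlin
  have := hlin.ennrpow_const (1 / 2 : ℝ)
  rw [ENNReal.zero_rpow_of_pos (by norm_num)] at this
  refine this.congr fun n => ?_
  rw [eLpNorm_eq_lintegral_rpow_enorm_toReal (by norm_num) (by norm_num)]
  simp

theorem tendsto_eLpNorm_comp_sub {μ : Measure E3} {φ : ℕ → E3 → ℝ} {w : E3 → ℝ} {G G' : ℝ → ℝ}
    {C : ℝ} (hG : ∀ s, HasDerivAt G (G' s) s) (hC : ∀ s, |G' s| ≤ C)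
    (h : Tendsto (fun n => eLpNorm (fun x => φ n x - w x) 2 μ) atTop (𝓝 0)) :
    Tendsto (fun n => eLpNorm (fun x => G (φ n x) - G (w x)) 2 μ) atTop (𝓝 0) := by
  have hlim : Tendsto (fun n => ENNReal.ofReal C * eLpNorm (fun x => φ n x - w x) 2 μ) atTop
      (𝓝 0) := by
    simpa using ENNReal.Tendsto.const_mul h (Or.inr ENNReal.ofReal_ne_top)
  refine tendsto_of_tendsto_of_tendsto_of_le_of_le tendsto_const_nhds hlim
    (fun _ => zero_le) fun n => ?_
  exact eLpNorm_le_mul_eLpNorm_of_ae_le_mul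
    (.of_forall fun x => abs_sub_le_of_hasDerivAt hG hC _ _) 2

/-- Traces commute with composition with Lipschitz `C¹` functions. -/
theorem HasTrace.comp_real (hΩ : IsOpen Ω) (hfin : volume Ω ≠ ⊤) (hsurf : surf (frontier Ω) ≠ ⊤)
    (h : HasTrace Ω u Du τ) {G G' : ℝ → ℝ} {C : ℝ}
    (hG : ∀ s, HasDerivAt G (G' s) s) (hG'c : Continuous G') (hC : ∀ s, |G' s| ≤ C) :
    HasTrace Ω (fun x => G (u x)) (fun x => G' (u x) • Du x) (fun x => G (τ x)) := by
  have : IsFiniteMeasure (surf.restrict (frontier Ω)) := ⟨by simpa using hsurf.lt_top⟩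
  obtain ⟨hH, hτ, φ, hφ, a, b, c⟩ := h
  -- The gradients of the composed approximations carry the factor `G' (φ n)` with `G'` merely
  -- continuous. An a.e. convergent subsequence makes dominated convergence available.
  have hmeas := tendstoInMeasure_of_tendsto_eLpNorm (by norm_num)
    (fun n => (hφ n).continuous.aestronglyMeasurable) hH.memLp.aestronglyMeasurable a
  obtain ⟨ns, hns, hae⟩ := hmeas.exists_seq_tendsto_ae
  have hnt := hns.tendsto_atTop
  have hG1 : ContDiff ℝ 1 G := by
    refine contDiff_one_iff_deriv.2 ⟨fun s => (hG s).differentiableAt, ?_⟩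
    rwa [show deriv G = G' from funext fun s => (hG s).deriv]
  refine ⟨hH.comp_real hΩ hfin hG hG'c hC, memLp_comp_of_hasDerivAt hτ hG hC,
    fun n x => G (φ (ns n) x), fun n => hG1.comp (hφ _),
    tendsto_eLpNorm_comp_sub hG hC (a.comp hnt), ?_, tendsto_eLpNorm_comp_sub hG hC (c.comp hnt)⟩
  have hg : ∀ n x, gradient (fun x => G (φ n x)) x = G' (φ n x) • gradient (φ n) x := by
    intro n x
    have hd := (hG (φ n x)).comp_hasFDerivAt x ((hφ n).differentiable (by simp) x).hasFDerivAt
    have hd' : fderiv ℝ (fun x => G (φ n x)) x = _ := hd.fderiv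
    simp only [gradient]
    rw [hd', map_smul]
  have hGm : ∀ n, AEStronglyMeasurable (fun x => G' (φ n x)) (volume.restrict Ω) := fun n =>
    (hG'c.comp (hφ n).continuous).aestronglyMeasurable
  have hGu : AEStronglyMeasurable (fun x => G' (u x)) (volume.restrict Ω) :=
    hG'c.comp_aestronglyMeasurable hH.memLp.aestronglyMeasurable
  have lim1 : Tendsto (fun n => eLpNorm (fun x => (G' (φ (ns n) x) - G' (u x)) • Du x) 2
      (volume.restrict Ω)) atTop (𝓝 0) := by
    refine tendsto_eLpNorm_smul_of_tendsto_ae (C := C + C) (fun n => (hGm _).sub hGu)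
      (fun n x => (abs_sub _ _).trans (add_le_add (hC _) (hC _))) hH.memLp_grad ?_
    filter_upwards [hae] with x hx
    have := ((hG'c.tendsto _).comp hx).sub_const (G' (u x))
    simpa using this
  have lim2 : Tendsto (fun n => eLpNorm
      (fun x => G' (φ (ns n) x) • (gradient (φ (ns n)) x - Du x)) 2 (volume.restrict Ω)) atTop
      (𝓝 0) := by
    have hlim : Tendsto (fun n => ENNReal.ofReal C *
        eLpNorm (fun x => gradient (φ (ns n)) x - Du x) 2 (volume.restrict Ω)) atTop (𝓝 0) := by
      simpa using ENNReal.Tendsto.const_mul (b.comp hnt) (Or.inr ENNReal.ofReal_ne_top)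
    refine tendsto_of_tendsto_of_tendsto_of_le_of_le tendsto_const_nhds hlim
      (fun _ => zero_le) fun n => ?_
    refine eLpNorm_le_mul_eLpNorm_of_ae_le_mul (.of_forall fun x => ?_) 2
    rw [norm_smul]
    exact mul_le_mul_of_nonneg_right (hC _) (norm_nonneg _)
  refine tendsto_of_tendsto_of_tendsto_of_le_of_le tendsto_const_nhds
    (by simpa using lim1.add lim2) (fun _ => zero_le) fun n => ?_
  have hgr := (continuous_gradient (hφ (ns n))).aestronglyMeasurable (μ := volume.restrict Ω)
  refine (le_of_eq ?_).trans (eLpNorm_add_le (((hGm (ns n)).sub hGu).smul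
    hH.memLp_grad.aestronglyMeasurable) ((hGm (ns n)).smul
      (hgr.sub hH.memLp_grad.aestronglyMeasurable)) (by norm_num))
  congr 1
  ext1 x
  simp only [hg, Pi.add_apply]
  rw [sub_smul, smul_sub]
  abel

end Trace

/-! ### One-sided truncations -/

/-- A bounded `C¹` function vanishing exactly on `(-∞, 0]`. -/
def ramp (s : ℝ) : ℝ := max s 0 ^ 2 / (1 + max s 0 ^ 2)

/-- The derivative of `ramp`. -/
def rampDeriv (s : ℝ) : ℝ := 2 * max s 0 / (1 + max s 0 ^ 2) ^ 2

/-- The primitive of `ramp` vanishing at the origin. -/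
def rampPrimitive (s : ℝ) : ℝ := ∫ r in (0 : ℝ)..s, ramp r

theorem hasDerivAt_max_zero_sq (s : ℝ) : HasDerivAt (fun s : ℝ => max s 0 ^ 2) (2 * max s 0) s := by
  rcases lt_trichotomy s 0 with hs | rfl | hs
  · rw [max_eq_right hs.le, mul_zero]
    refine (hasDerivAt_const s (0 : ℝ)).congr_of_eventuallyEq ?_
    filter_upwards [gt_mem_nhds hs] with r hr
    simp [max_eq_right (le_of_lt hr)]
  · rw [max_self, mul_zero, hasDerivAt_iff_isLittleO_nhds_zero]
    simp only [zero_add, max_self, smul_zero, sub_zero, ne_eq, OfNat.ofNat_ne_zero,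
      not_false_eq_true, zero_pow]
    have h1 : (fun h : ℝ => max h 0 ^ 2) =O[𝓝 0] fun h : ℝ => h ^ 2 :=
      Asymptotics.IsBigO.of_bound 1 (.of_forall fun h => by
        rw [one_mul, norm_pow, norm_pow, Real.norm_eq_abs, Real.norm_eq_abs]
        refine pow_le_pow_left₀ (abs_nonneg _) ?_ 2
        rw [abs_of_nonneg (le_max_right h 0)]
        exact max_le (le_abs_self h) (abs_nonneg h))
    exact h1.trans_isLittleO (Asymptotics.isLittleO_pow_id one_lt_two)
  · rw [max_eq_left hs.le]
    have : HasDerivAt (fun r : ℝ => r ^ 2) (2 * s) s := by simpa using hasDerivAt_pow 2 s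
    refine this.congr_of_eventuallyEq ?_
    filter_upwards [lt_mem_nhds hs] with r hr
    rw [max_eq_left (le_of_lt hr)]

theorem hasDerivAt_ramp (s : ℝ) : HasDerivAt ramp (rampDeriv s) s := by
  have h := hasDerivAt_max_zero_sq s
  have h2 := h.div (h.const_add 1) (by positivity)
  refine h2.congr_deriv ?_
  rw [rampDeriv]
  congr 1
  ring

theorem continuous_rampDeriv : Continuous rampDeriv := by
  unfold rampDeriv
  refine Continuous.div (by fun_prop) (by fun_prop) fun s => by positivity

theorem ramp_nonneg (s : ℝ) : 0 ≤ ramp s := by unfold ramp; positivity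

theorem ramp_le_one (s : ℝ) : ramp s ≤ 1 := by
  unfold ramp
  rw [div_le_one (by positivity)]
  linarith

theorem ramp_eq_zero_iff {s : ℝ} : ramp s = 0 ↔ s ≤ 0 := by
  unfold ramp
  rw [div_eq_zero_iff, or_iff_left (by positivity)]
  simp

theorem rampDeriv_nonneg (s : ℝ) : 0 ≤ rampDeriv s := by
  have := le_max_right s 0
  unfold rampDeriv; positivity

theorem rampDeriv_le_two (s : ℝ) : rampDeriv s ≤ 2 := by
  unfold rampDeriv
  have := le_max_right s 0
  rw [div_le_iff₀ (by positivity)]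
  nlinarith [sq_nonneg (max s 0 - 1), sq_nonneg (max s 0), sq_nonneg (max s 0 ^ 2)]

theorem hasDerivAt_rampPrimitive (s : ℝ) : HasDerivAt rampPrimitive (ramp s) s :=
  have hc : Continuous ramp := continuous_of_hasDerivAt hasDerivAt_ramp
  intervalIntegral.integral_hasDerivAt_right (hc.intervalIntegrable _ _)
    (hc.stronglyMeasurableAtFilter _ _) hc.continuousAt

theorem rampPrimitive_eq_zero {s : ℝ} (hs : s ≤ 0) : rampPrimitive s = 0 := by
  unfold rampPrimitive
  rw [intervalIntegral.integral_congr (g := fun _ => 0) fun r hr => ?_]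
  · simp
  · rw [uIcc_of_ge hs] at hr
    exact ramp_eq_zero_iff.2 hr.2

theorem rampPrimitive_nonneg (s : ℝ) : 0 ≤ rampPrimitive s := by
  rcases le_total s 0 with hs | hs
  · rw [rampPrimitive_eq_zero hs]
  · exact intervalIntegral.integral_nonneg hs fun r _ => ramp_nonneg r

theorem rampPrimitive_pos {s : ℝ} (hs : 0 < s) : 0 < rampPrimitive s := by
  have hc : Continuous ramp := continuous_of_hasDerivAt hasDerivAt_ramp
  refine intervalIntegral.intervalIntegral_pos_of_pos_on (hc.intervalIntegrable _ _)
    (fun r hr => ?_) hs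
  exact lt_of_le_of_ne (ramp_nonneg r) fun h => absurd (ramp_eq_zero_iff.1 h.symm) (not_le.2 hr.1)

/-- A penalty for exceeding `M`. Squaring in `ramp` removes the kink of the positive part, and the
quotient keeps the truncation bounded. -/
theorem isTruncation_upper (M : ℝ) : IsTruncation (fun s => rampPrimitive (s - M))
    (fun s => ramp (s - M)) (fun s => rampDeriv (s - M)) 2 where
  hasDerivAt s := (hasDerivAt_rampPrimitive (s - M)).comp_sub_const s M
  hasDerivAt' s := (hasDerivAt_ramp (s - M)).comp_sub_const s M
  continuous := continuous_rampDeriv.comp (by fun_prop)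
  abs_le_one s := by rw [abs_of_nonneg (ramp_nonneg _)]; exact ramp_le_one _
  nonneg s := rampDeriv_nonneg _
  le s := rampDeriv_le_two _

theorem isTruncation_lower (M : ℝ) : IsTruncation (fun s => rampPrimitive (M - s))
    (fun s => -ramp (M - s)) (fun s => rampDeriv (M - s)) 2 where
  hasDerivAt s := (hasDerivAt_rampPrimitive (M - s)).comp_const_sub M s
  hasDerivAt' s := by simpa using ((hasDerivAt_ramp (M - s)).comp_const_sub M s).fun_neg
  continuous := continuous_rampDeriv.comp (by fun_prop)
  abs_le_one s := by rw [abs_neg, abs_of_nonneg (ramp_nonneg _)]; exact ramp_le_one _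
  nonneg s := rampDeriv_nonneg _
  le s := rampDeriv_le_two _

/-! ### Values of the liquid concentration outside the phase diagram -/

namespace PhaseDiagram

variable (P : PhaseDiagram)

theorem θE_mem : P.θE ∈ Icc P.θE P.θF := left_mem_Icc.2 P.θE_lt_θF.le

theorem θF_mem : P.θF ∈ Icc P.θE P.θF := right_mem_Icc.2 P.θE_lt_θF.le

theorem cE_pos : 0 < P.cE := by
  have := P.strictAntiOn_γl P.θE_mem P.θF_mem P.θE_lt_θF
  rwa [P.γl_θF] at this

theorem cA_lt_cE : P.cA < P.cE := P.γs_lt_γl _ ⟨le_rfl, P.θE_lt_θF⟩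

/-- The strip is closed, so it suffices to place each zone in it. For the mixture zone this is the
monotonicity of both curves, compared with their values at `θF` and `θE`. Points off the strip
therefore belong to `zoneMinus` or `zonePlus`. -/
theorem closure_zones_subset :
    closure (P.zoneL ∪ P.zoneS ∪ P.zoneM) ⊆ {z | 0 ≤ z.1 ∧ z.1 ≤ P.cE} := by
  refine closure_minimal ?_ ((isClosed_le continuous_const continuous_fst).inter
    (isClosed_le continuous_fst continuous_const))
  rintro z ((hz | hz) | hz)
  · exact ⟨hz.1.le, hz.2.1.le⟩
  · exact ⟨hz.1.le, (hz.2.1.trans P.cA_lt_cE).le⟩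
  · obtain ⟨h1, h2, h3, h4⟩ := hz
    have hmem : z.2 ∈ Icc P.θE P.θF := ⟨h1.le, h2.le⟩
    have hs := P.strictAntiOn_γs hmem P.θF_mem h2
    rw [P.γs_θF] at hs
    have hl := P.strictAntiOn_γl P.θE_mem hmem h1
    exact ⟨(hs.trans h3).le, (h4.trans hl).le⟩

theorem cl_of_neg {z : ℝ × ℝ} (hz : z.1 < 0) : P.cl z = 0 := by
  have h1 : z ∉ P.zoneL := fun h => absurd h.1 (not_lt.2 hz.le)
  have h2 : z ∉ P.zoneS := fun h => absurd h.1 (not_lt.2 hz.le)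
  have h3 : z ∈ closure P.zoneMinus :=
    subset_closure ⟨hz, fun h => absurd (P.closure_zones_subset h).1 (not_le.2 hz)⟩
  simp [cl, h1, h2, h3]

theorem cl_of_gt {z : ℝ × ℝ} (hz : P.cE < z.1) : P.cl z = P.cE := by
  have hpos := P.cE_pos.trans hz
  have h1 : z ∉ P.zoneL := fun h => absurd h.2.1 (not_lt.2 hz.le)
  have h2 : z ∉ P.zoneS := fun h => absurd (h.2.1.trans P.cA_lt_cE) (not_lt.2 hz.le)
  have h3 : z ∉ closure P.zoneMinus := fun h => by
    have hsub : closure P.zoneMinus ⊆ {z | z.1 ≤ 0} :=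
      closure_minimal (fun w hw => show w.1 ≤ 0 from le_of_lt hw.1) (isClosed_le continuous_fst continuous_const)
    exact absurd (hsub h) (not_le.2 hpos)
  have h4 : z ∈ closure P.zonePlus :=
    subset_closure ⟨hpos, fun h => absurd (P.closure_zones_subset h).2 (not_le.2 hz)⟩
  simp [cl, h1, h2, h3, h4]

end PhaseDiagram

/-! ### Maximum principles for weak reproductive solutions -/

/-- Fubini for a nonnegative function: it converts information on time slices into a statement a.e.
on the cylinder. -/
theorem ae_eq_zero_of_ae_ae {Ω : Set E3} {T : ℝ} {w : ℝ × E3 → ℝ}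
    (hi : Integrable w (cylinder Ω T)) (hw : ∀ p, 0 ≤ w p)
    (h : ∀ᵐ t ∂volume.restrict (Ioo 0 T), ∫ x in Ω, w (t, x) ≤ 0) :
    ∀ᵐ p ∂cylinder Ω T, w p = 0 := by
  refine (integral_eq_zero_iff_of_nonneg hw hi).1 (le_antisymm ?_ (integral_nonneg hw))
  rw [cylinder, integral_prod _ hi]
  exact integral_nonpos_of_ae h

namespace IsWeakReproductiveSolutionWith

variable {D : Data} {c θ : ℝ → E3 → ℝ} {v : ℝ → E3 → E3} {c₀ θ₀ : E3 → ℝ} {v₀ : E3 → E3}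
  {Dc Dθ : ℝ → E3 → E3} {Dv : ℝ → Fin 3 → E3 → E3} {Dcl : ℝ → E3 → E3} {Φ G G' : ℝ → ℝ} {C : ℝ}

theorem volume_ne_top (D : Data) : volume D.Ω ≠ ⊤ := D.isBounded.measure_lt_top.ne

/-- If the liquid concentration is constant where the truncation `G` of the concentration is not
zero, and the mass constraint prevents `G` from being nonzero everywhere, then `G` vanishes. -/
theorem truncation_concentration_eq_zero
    (h : IsWeakReproductiveSolutionWith D c θ v c₀ θ₀ v₀ Dc Dθ Dv Dcl)
    (htr : IsTruncation Φ G G' C) {k : ℝ}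
    (hcl : ∀ z : ℝ × ℝ, G z.1 ≠ 0 → D.P.cl z = k)
    (hmass : ∀ᵐ t ∂volume.restrict (Ioo 0 D.T), ¬ ∀ᵐ x ∂volume.restrict D.Ω, G (c t x) ≠ 0) :
    ∀ᵐ p ∂D.Q, G (c p.1 p.2) = 0 := by
  have hfin := volume_ne_top D
  have hΩ := D.isOpen
  have hm := hΩ.measurableSet
  have : IsFiniteMeasure (volume.restrict D.Ω) := ⟨by simpa using hfin.lt_top⟩
  have hcyl : IsFiniteMeasure (cylinder D.Ω D.T) := by unfold cylinder; infer_instance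
  have hf : Integrable (fun p : ℝ × E3 => inner ℝ (v p.1 p.2) (Dcl p.1 p.2))
      (cylinder D.Ω D.T) := integrable_inner_of_memLp h.v_memLp h.cl_mem.memLp_grad
  have heq : ∀ᵐ t ∂volume.restrict (Ioo 0 D.T), SatisfiesBalance D.Ω D.T D.η c Dc
      (fun s x => inner ℝ (v s x) (Dcl s x)) (fun x => G (c t x))
      (fun x => G' (c t x) • Dc t x) := by
    filter_upwards [h.c_mem.isH1] with t ht
    exact h.eq_c _ _ (ht.comp_real hΩ hfin htr.hasDerivAt' htr.continuous htr.abs_le)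
  have hen := energy_inequality hm hfin D.T_pos h.c_mem h.c_cont hf htr heq
    (right_mem_Ioc.2 D.T_pos)
  have hE : ∫ x in D.Ω, Φ (c D.T x) = ∫ x in D.Ω, Φ (c 0 x) := by
    refine integral_congr_ae ?_
    filter_upwards [h.c_periodic] with x hx
    rw [hx]
  have hGm : AEStronglyMeasurable (fun p : ℝ × E3 => G (c p.1 p.2)) (cylinder D.Ω D.T) :=
    htr.continuous_deriv.comp_aestronglyMeasurable h.c_mem.memLp.aestronglyMeasurable
  have hfG : Integrable (fun p : ℝ × E3 => inner ℝ (v p.1 p.2) (Dcl p.1 p.2) * G (c p.1 p.2))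
      (cylinder D.Ω D.T) :=
    hf.mul_bdd (c := 1) hGm (.of_forall fun p => htr.abs_le_one _)
  have hDD : Integrable (fun p : ℝ × E3 => G' (c p.1 p.2) * ‖Dc p.1 p.2‖ ^ 2)
      (cylinder D.Ω D.T) := by
    have := integrable_inner_of_memLp h.c_mem.memLp_grad (memLp_smul_of_bounded
      (htr.continuous.comp_aestronglyMeasurable h.c_mem.memLp.aestronglyMeasurable)
      (fun x => htr.abs_le _) h.c_mem.memLp_grad)
    refine this.congr (.of_forall fun p => ?_)
    simp only [real_inner_smul_right, real_inner_self_eq_norm_sq]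
  -- Where `G` is nonzero the liquid concentration equals `k`, and its weak gradient vanishes a.e.
  -- on that level set.
  have hzero : ∫ p, inner ℝ (v p.1 p.2) (Dcl p.1 p.2) * G (c p.1 p.2) ∂cylinder D.Ω D.T = 0 := by
    rw [cylinder, integral_prod _ hfG]
    refine integral_eq_zero_of_ae ?_
    filter_upwards [h.cl_mem.isH1] with t ht
    refine integral_eq_zero_of_ae ?_
    filter_upwards [ht.grad_eq_zero_of_eq hΩ hfin k] with x hx
    by_cases hG0 : G (c t x) = 0
    · simp [hG0]
    · simp [hx (hcl (c t x, θ t x) hG0)]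
  rw [integral_add (hDD.const_mul D.η) hfG, hzero, integral_const_mul, hE, add_zero] at hen
  have hnn : ∀ p : ℝ × E3, 0 ≤ G' (c p.1 p.2) * ‖Dc p.1 p.2‖ ^ 2 := fun p =>
    mul_nonneg (htr.nonneg _) (sq_nonneg _)
  -- Periodicity cancels the two energies, so the nonnegative dissipation is all that remains.
  have hint0 : ∫ p, G' (c p.1 p.2) * ‖Dc p.1 p.2‖ ^ 2 ∂cylinder D.Ω D.T = 0 := by
    refine le_antisymm ?_ (integral_nonneg hnn)
    nlinarith [D.η_pos]
  have hae := (integral_eq_zero_iff_of_nonneg hnn hDD).1 hint0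
  have hslice : ∀ᵐ t ∂volume.restrict (Ioo 0 D.T), ∀ᵐ x ∂volume.restrict D.Ω,
      G' (c t x) * ‖Dc t x‖ ^ 2 = 0 := Measure.ae_ae_of_ae_prod hae
  have habs : ∀ᵐ p ∂cylinder D.Ω D.T, |G (c p.1 p.2)| = 0 := by
    refine ae_eq_zero_of_ae_ae (Integrable.of_bound hGm.norm 1 (.of_forall fun p => ?_))
      (fun p => abs_nonneg _) ?_
    · rw [Real.norm_eq_abs, abs_abs]
      exact htr.abs_le_one _
    filter_upwards [hslice, h.c_mem.isH1, hmass] with t ht htH htm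
    have hH := htH.comp_real hΩ hfin htr.hasDerivAt' htr.continuous htr.abs_le
    -- At almost every point either `G'` or the gradient of `c` vanishes, so the truncation has zero
    -- weak gradient. The constant `a` must be zero because of `hmass`.
    obtain ⟨a, ha⟩ := ae_eq_const_of_weak_grad_eq_zero hΩ D.isConnected (hH.integrableOn hfin)
      (hH.integrableOn_grad hfin) hH.weak (by
        filter_upwards [ht] with x hx
        rcases mul_eq_zero.1 hx with h0 | h0
        · simp [h0]
        · have : Dc t x = 0 := by simpa using h0
          simp [this])
    have ha0 : a = 0 := by
      by_contra hne
      refine htm ?_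
      filter_upwards [ha] with x hx
      rwa [hx]
    refine (integral_eq_zero_of_ae ?_).le
    filter_upwards [ha] with x hx
    simp [hx, ha0]
  filter_upwards [habs] with p hp
  exact abs_eq_zero.1 hp

/-- If the truncation `Φ` of the temperature vanishes initially and its derivative `G` vanishes on
the part of the boundary where the temperature is prescribed, then `Φ` vanishes. -/
theorem truncation_temperature_eq_zero
    (h : IsWeakReproductiveSolutionWith D c θ v c₀ θ₀ v₀ Dc Dθ Dv Dcl)
    (htr : IsTruncation Φ G G' C) (hΦ : ∀ s, 0 ≤ Φ s)
    (hinit : ∀ᵐ x ∂volume.restrict D.Ω, Φ (θ₀ x) = 0)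
    (hbdry : ∀ᵐ t ∂volume.restrict (Ioo 0 D.T), ∀ᵐ x ∂surf.restrict (D.Γb ∪ D.Γt),
      G (D.θδ t x) = 0) :
    ∀ᵐ p ∂D.Q, Φ (θ p.1 p.2) = 0 := by
  have hfin := volume_ne_top D
  have hΩ := D.isOpen
  have hm := hΩ.measurableSet
  have : IsFiniteMeasure (volume.restrict D.Ω) := ⟨by simpa using hfin.lt_top⟩
  have hcyl : IsFiniteMeasure (cylinder D.Ω D.T) := by unfold cylinder; infer_instance
  have hsurf := (surf_frontier_lt_top hΩ D.isBounded D.boundary_C2).ne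
  have hf : Integrable (fun p : ℝ × E3 => D.ρ * D.Cp * inner ℝ (v p.1 p.2) (Dθ p.1 p.2))
      (cylinder D.Ω D.T) :=
    (integrable_inner_of_memLp h.v_memLp h.θ_mem.memLp_grad).const_mul _
  have heq : ∀ᵐ t ∂volume.restrict (Ioo 0 D.T), SatisfiesBalance D.Ω D.T D.κ θ Dθ
      (fun s x => D.ρ * D.Cp * inner ℝ (v s x) (Dθ s x)) (fun x => G (θ t x))
      (fun x => G' (θ t x) • Dθ t x) := by
    filter_upwards [h.θ_boundary, D.ext_trace, hbdry] with t ht₁ ht₂ ht₃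
    obtain ⟨τ₁, hτ₁, hz₁⟩ := ht₁
    obtain ⟨τ₂, hτ₂, hz₂⟩ := ht₂
    -- The sum has trace `θδ` on `Γbt`, where `G` is zero by assumption; this makes the truncated
    -- temperature an admissible test function.
    have hsum := hτ₁.add hfin hτ₂
    simp only [sub_add_cancel] at hsum
    have htrace := hsum.comp_real hΩ hfin hsurf htr.hasDerivAt' htr.continuous htr.abs_le
    have hmem : MemHtheta D.Ω D.Γbt (fun x => G (θ t x)) (fun x => G' (θ t x) • Dθ t x) := by
      refine ⟨_, htrace, ?_⟩
      rw [Data.Γbt] at hz₁ ⊢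
      filter_upwards [hz₁, hz₂, ht₃] with x h1 h2 h3
      rw [h1, h2, zero_add, h3]
    intro ζ hζ
    have := h.eq_θ _ _ hmem ζ hζ
    simp only [mul_assoc _ (inner ℝ _ _) (G _), integral_const_mul]
    exact this
  have hGm : AEStronglyMeasurable (fun p : ℝ × E3 => G (θ p.1 p.2)) (cylinder D.Ω D.T) :=
    htr.continuous_deriv.comp_aestronglyMeasurable h.θ_mem.memLp.aestronglyMeasurable
  have hfG : Integrable (fun p : ℝ × E3 =>
      D.ρ * D.Cp * inner ℝ (v p.1 p.2) (Dθ p.1 p.2) * G (θ p.1 p.2)) (cylinder D.Ω D.T) :=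
    hf.mul_bdd (c := 1) hGm (.of_forall fun p => htr.abs_le_one _)
  have hDD : Integrable (fun p : ℝ × E3 => G' (θ p.1 p.2) * ‖Dθ p.1 p.2‖ ^ 2)
      (cylinder D.Ω D.T) := by
    have := integrable_inner_of_memLp h.θ_mem.memLp_grad (memLp_smul_of_bounded
      (htr.continuous.comp_aestronglyMeasurable h.θ_mem.memLp.aestronglyMeasurable)
      (fun x => htr.abs_le _) h.θ_mem.memLp_grad)
    refine this.congr (.of_forall fun p => ?_)
    simp only [real_inner_smul_right, real_inner_self_eq_norm_sq]
  have hE0 : ∫ x in D.Ω, Φ (θ 0 x) = 0 := by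
    refine integral_eq_zero_of_ae ?_
    filter_upwards [h.θ_periodic, h.θ_T, hinit] with x h1 h2 h3
    rw [h1, h2, h3]
    rfl
  have hE : ∀ t ∈ Ioc 0 D.T, ∫ x in D.Ω, Φ (θ t x) ≤ 0 := by
    intro t ht
    have hen := energy_inequality hm hfin D.T_pos h.θ_mem h.θ_cont hf htr heq ht
    have hle := cylinder_mono D.Ω ht.2
    have hzero : ∫ p, D.ρ * D.Cp * inner ℝ (v p.1 p.2) (Dθ p.1 p.2) * G (θ p.1 p.2)
        ∂cylinder D.Ω t = 0 := by
      rw [cylinder, integral_prod _ (hfG.mono_measure hle)]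
      refine integral_eq_zero_of_ae ?_
      filter_upwards [ae_restrict_of_ae_restrict_of_subset (Ioo_subset_Ioo_right ht.2) h.θ_mem.isH1,
        ae_restrict_of_ae_restrict_of_subset (Ioo_subset_Ioo_right ht.2) h.v_memH] with s hs hsv
      -- The product of `G(θ)` and `∇θ` is the gradient of `Φ(θ) ∈ H¹`, to which the fields of `H`
      -- are orthogonal.
      have := hsv.normal_eq_zero _ _
        (hs.comp_real hΩ hfin htr.hasDerivAt htr.continuous_deriv htr.abs_le_one)
      simp only [real_inner_smul_right] at this
      simp only [mul_assoc _ (inner ℝ _ _) (G _), integral_const_mul,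
        mul_comm (inner ℝ _ _) (G _), this, mul_zero, Pi.zero_apply]
    rw [integral_add ((hDD.mono_measure hle).const_mul D.κ) (hfG.mono_measure hle), hzero,
      integral_const_mul, hE0, add_zero] at hen
    have : 0 ≤ D.κ * ∫ p, G' (θ p.1 p.2) * ‖Dθ p.1 p.2‖ ^ 2 ∂cylinder D.Ω t :=
      mul_nonneg D.κ_pos.le (integral_nonneg fun p => mul_nonneg (htr.nonneg _) (sq_nonneg _))
    linarith
  refine ae_eq_zero_of_ae_ae (w := fun p => Φ (θ p.1 p.2))
    ((memLp_comp_of_hasDerivAt h.θ_mem.memLp htr.hasDerivAt htr.abs_le_one).integrable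
      (by norm_num)) (fun p => hΦ _) ?_
  filter_upwards [ae_restrict_mem measurableSet_Ioo] with t ht
  exact hE t ⟨ht.1, ht.2.le⟩

/-! ### From vanishing truncations to the pointwise bounds. -/

theorem integrable_concentration
    (h : IsWeakReproductiveSolutionWith D c θ v c₀ θ₀ v₀ Dc Dθ Dv Dcl) :
    ∀ᵐ t ∂volume.restrict (Ioo 0 D.T), IntegrableOn (c t) D.Ω := by
  filter_upwards [h.c_mem.isH1] with t ht using ht.integrableOn (volume_ne_top D)

theorem volume_restrict_ne_zero (D : Data) : volume.restrict D.Ω ≠ 0 := by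
  rw [Ne, Measure.restrict_eq_zero]
  exact (D.isOpen.measure_pos volume ⟨0, D.zero_mem⟩).ne'

/-- A function that is almost everywhere larger than a constant has a larger integral. -/
theorem mul_volume_lt_integral {w : E3 → ℝ} {M : ℝ} (hw : IntegrableOn w D.Ω)
    (hlt : ∀ᵐ x ∂volume.restrict D.Ω, M < w x) : M * volume.real D.Ω < ∫ x in D.Ω, w x := by
  have : IsFiniteMeasure (volume.restrict D.Ω) := ⟨by simpa using (volume_ne_top D).lt_top⟩
  have hi : Integrable (fun x => w x - M) (volume.restrict D.Ω) := hw.sub (integrable_const M)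
  have hpos : 0 < ∫ x in D.Ω, (w x - M) := by
    refine (integral_pos_iff_support_of_nonneg_ae ?_ hi).2 ?_
    · filter_upwards [hlt] with x hx using (sub_pos.2 hx).le
    · rw [pos_iff_ne_zero]
      intro h0
      refine volume_restrict_ne_zero D (Measure.measure_univ_eq_zero.1
        (measure_mono_null (t := Function.support (fun x => w x - M) ∪
          {x | ¬ M < w x}) (fun x _ => ?_) (measure_union_null h0 hlt)))
      by_cases hx : M < w x
      · exact Or.inl (sub_pos.2 hx).ne'
      · exact Or.inr hx
  rw [integral_sub hw (integrable_const M), integral_const, smul_eq_mul,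
    measureReal_restrict_apply_univ] at hpos
  linarith

/-- If `c(t)` exceeded `cE` almost everywhere, its mass would be strictly larger than `cE |Ω|`,
hence than `cg`. -/
theorem concentration_le (h : IsWeakReproductiveSolutionWith D c θ v c₀ θ₀ v₀ Dc Dθ Dv Dcl) :
    ∀ᵐ p ∂D.Q, c p.1 p.2 ≤ D.P.γl D.P.θE := by
  have hgt : ∀ s, ramp (s - D.P.cE) ≠ 0 → D.P.cE < s := fun s hs => by
    by_contra! hle
    exact hs (ramp_eq_zero_iff.2 (by linarith))
  have := h.truncation_concentration_eq_zero (isTruncation_upper D.P.cE)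
    (k := D.P.cE)
    (fun z hz => D.P.cl_of_gt (hgt _ hz)) (by
      filter_upwards [h.mass, h.integrable_concentration] with t ht hti hall
      have hlt := mul_volume_lt_integral hti (hall.mono fun x hx => hgt _ hx)
      rw [ht] at hlt
      exact absurd D.cg_le (not_le.2 hlt))
  filter_upwards [this] with p hp
  exact sub_nonpos.1 (ramp_eq_zero_iff.1 hp)

/-- A concentration negative almost everywhere would have negative mass, contrary to `cg ≥ 0`. -/
theorem concentration_nonneg (h : IsWeakReproductiveSolutionWith D c θ v c₀ θ₀ v₀ Dc Dθ Dv Dcl) :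
    ∀ᵐ p ∂D.Q, 0 ≤ c p.1 p.2 := by
  have hlt : ∀ s, -ramp (0 - s) ≠ 0 → s < 0 := fun s hs => by
    by_contra! hle
    exact hs (by rw [ramp_eq_zero_iff.2 (by linarith), neg_zero])
  have := h.truncation_concentration_eq_zero (isTruncation_lower 0)
    (k := 0)
    (fun z hz => D.P.cl_of_neg (hlt _ hz)) (by
      filter_upwards [h.mass, h.integrable_concentration] with t ht hti hall
      have hlt' := mul_volume_lt_integral (M := 0) hti.neg
        (hall.mono fun x hx => neg_pos.2 (hlt _ hx))
      simp only [Pi.neg_apply] at hlt'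
      rw [integral_neg, ht, zero_mul] at hlt'
      linarith [D.cg_nonneg])
  filter_upwards [this] with p hp
  have := ramp_eq_zero_iff.1 (neg_eq_zero.1 hp)
  linarith

/-- Truncation requires a real level, but the bound may be infinite. Rational levels above it
suffice: they are countable, so the exceptional null sets can be united, and they approximate the
bound from above. An infinite supremum admits no such level. -/
theorem temperature_le (h : IsWeakReproductiveSolutionWith D c θ v c₀ θ₀ v₀ Dc Dθ Dv Dcl) :
    ∀ᵐ p ∂D.Q, (θ p.1 p.2 : EReal) ≤ D.θsup θ₀ := by
  have key : ∀ q : ℚ, D.θsup θ₀ ≤ ((q : ℝ) : EReal) → ∀ᵐ p ∂D.Q, θ p.1 p.2 ≤ q := by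
    intro q hq
    have h1 : ∀ᵐ x ∂volume.restrict D.Ω, θ₀ x ≤ q := by
      filter_upwards [ae_le_essSup (f := fun x => (θ₀ x : EReal)) (μ := volume.restrict D.Ω)]
        with x hx
      exact EReal.coe_le_coe_iff.1 (hx.trans ((le_max_left _ _).trans hq))
    have h2 : ∀ᵐ t ∂volume.restrict (Ioo 0 D.T), ∀ᵐ x ∂surf.restrict (D.Γb ∪ D.Γt),
        D.θδ t x ≤ q := by
      filter_upwards [ae_le_essSup (f := fun t => essSup (fun x => ((D.θδ t x : ℝ) : EReal))
        (surf.restrict (D.Γb ∪ D.Γt))) (μ := volume.restrict (Ioo 0 D.T))] with t ht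
      filter_upwards [ae_le_essSup (f := fun x => ((D.θδ t x : ℝ) : EReal))
        (μ := surf.restrict (D.Γb ∪ D.Γt))] with x hx
      exact EReal.coe_le_coe_iff.1 (hx.trans (ht.trans ((le_max_right _ _).trans hq)))
    have := h.truncation_temperature_eq_zero (isTruncation_upper q)
      (fun s => rampPrimitive_nonneg _)
      (h1.mono fun x hx => rampPrimitive_eq_zero (sub_nonpos.2 hx))
      (h2.mono fun t ht => ht.mono fun x hx => ramp_eq_zero_iff.2 (sub_nonpos.2 hx))
    filter_upwards [this] with p hp
    by_contra! hlt
    exact (rampPrimitive_pos (sub_pos.2 hlt)).ne' hp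
  have hall : ∀ᵐ p ∂D.Q, ∀ q : ℚ, D.θsup θ₀ ≤ ((q : ℝ) : EReal) → θ p.1 p.2 ≤ q := by
    rw [ae_all_iff]
    intro q
    by_cases hq : D.θsup θ₀ ≤ ((q : ℝ) : EReal)
    · exact (key q hq).mono fun p hp _ => hp
    · exact .of_forall fun p hp => absurd hp hq
  filter_upwards [hall] with p hp
  by_contra! hlt
  obtain ⟨q, hq1, hq2⟩ := EReal.lt_iff_exists_rat_btwn.1 hlt
  exact absurd (EReal.coe_lt_coe_iff.1 hq2) (not_lt.2 (hp q hq1.le))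

theorem le_temperature (h : IsWeakReproductiveSolutionWith D c θ v c₀ θ₀ v₀ Dc Dθ Dv Dcl) :
    ∀ᵐ p ∂D.Q, D.θinf θ₀ ≤ (θ p.1 p.2 : EReal) := by
  have key : ∀ q : ℚ, ((q : ℝ) : EReal) ≤ D.θinf θ₀ → ∀ᵐ p ∂D.Q, q ≤ θ p.1 p.2 := by
    intro q hq
    have h1 : ∀ᵐ x ∂volume.restrict D.Ω, q ≤ θ₀ x := by
      filter_upwards [ae_essInf_le (f := fun x => (θ₀ x : EReal)) (μ := volume.restrict D.Ω)]
        with x hx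
      exact EReal.coe_le_coe_iff.1 ((hq.trans (min_le_left _ _)).trans hx)
    have h2 : ∀ᵐ t ∂volume.restrict (Ioo 0 D.T), ∀ᵐ x ∂surf.restrict (D.Γb ∪ D.Γt),
        q ≤ D.θδ t x := by
      filter_upwards [ae_essInf_le (f := fun t => essInf (fun x => ((D.θδ t x : ℝ) : EReal))
        (surf.restrict (D.Γb ∪ D.Γt))) (μ := volume.restrict (Ioo 0 D.T))] with t ht
      filter_upwards [ae_essInf_le (f := fun x => ((D.θδ t x : ℝ) : EReal))
        (μ := surf.restrict (D.Γb ∪ D.Γt))] with x hx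
      exact EReal.coe_le_coe_iff.1 (((hq.trans (min_le_right _ _)).trans ht).trans hx)
    have := h.truncation_temperature_eq_zero (isTruncation_lower q)
      (fun s => rampPrimitive_nonneg _)
      (h1.mono fun x hx => rampPrimitive_eq_zero (sub_nonpos.2 hx))
      (h2.mono fun t ht => ht.mono fun x hx => by
        rw [ramp_eq_zero_iff.2 (sub_nonpos.2 hx), neg_zero])
    filter_upwards [this] with p hp
    by_contra! hlt
    exact (rampPrimitive_pos (sub_pos.2 hlt)).ne' hp
  have hall : ∀ᵐ p ∂D.Q, ∀ q : ℚ, ((q : ℝ) : EReal) ≤ D.θinf θ₀ → q ≤ θ p.1 p.2 := by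
    rw [ae_all_iff]
    intro q
    by_cases hq : ((q : ℝ) : EReal) ≤ D.θinf θ₀
    · exact (key q hq).mono fun p hp _ => hp
    · exact .of_forall fun p hp => absurd hp hq
  filter_upwards [hall] with p hp
  by_contra! hlt
  obtain ⟨q, hq1, hq2⟩ := EReal.lt_iff_exists_rat_btwn.1 hlt
  exact absurd (EReal.coe_lt_coe_iff.1 hq1) (not_lt.2 (hp q hq2.le))

end IsWeakReproductiveSolutionWith

end

end Solidification

theorem proposition3p5 (D : Solidification.Data)
    (c θ : ℝ → Solidification.E3 → ℝ) (v : ℝ → Solidification.E3 → Solidification.E3)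
    (c₀ θ₀ : Solidification.E3 → ℝ) (v₀ : Solidification.E3 → Solidification.E3)
    (h : Solidification.IsWeakReproductiveSolution D c θ v c₀ θ₀ v₀) :
    (∀ᵐ p ∂D.Q, 0 ≤ c p.1 p.2 ∧ c p.1 p.2 ≤ D.P.γl D.P.θE) ∧
    (∀ᵐ p ∂D.Q, D.θinf θ₀ ≤ (θ p.1 p.2 : EReal) ∧ (θ p.1 p.2 : EReal) ≤ D.θsup θ₀) := by
  obtain ⟨Dc, Dθ, Dv, Dcl, h⟩ := h
  exact ⟨h.concentration_nonneg.and h.concentration_le, h.le_temperature.and h.temperature_le⟩
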